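/- Let $q\in\mathbb C$ with $0<|q|<1$, write $(x;q)_n=\prod_{j=0}^{n-1}(1-xq^j)$, $(x;q)_\infty=\lim_{n\to\infty}(x;q)_n$, $(x_1,\dots,x_m;q)_n=(x_1;q)_n\cdots(x_m;q)_n$ (for $n\in\mathbb N_0\cup\{\infty\}$), and $\Omega_q=\{q^{-k}:k=0,1,2,\dots\}$. For $b_1,\dots,b_s\notin\Omega_q$ let $$ {}_r\phi_s\left({a_1,\dots,a_r\atop b_1,\dots,b_s};q,z\right)=\sum_{k=0}^\infty\frac{(a_1,\dots,a_r;q)_k}{(q,b_1,\dots,b_s;q)_k}\left((-1)^kq^{\binom k2}\right)^{1+s-r}z^k, $$ and for an integer $p\ge 0$ let $$ {}_{r+1}W_r^{p}(a;a_4,\dots,a_{r+1};q,z)={}_{r+1}\phi_{r+p}\left({a,\,q\sqrt a,\,-q\sqrt a,\,a_4,\dots,a_{r+1}\atop \sqrt a,\,-\sqrt a,\,\frac{qa}{a_4},\dots,\frac{qa}{a_{r+1}},\,0,\dots,0};q,z\right) $$ with $p$ zeros among the denominator parameters. Let $a,b,c,d\in\mathbb C\setminus\{0\}$ with $\pm\sqrt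 a,\ \frac{qa}{b},\ \frac{qa}{c},\ \frac{qa}{d}\notin\Omega_q$. (i) Let $e\in\mathbb C\setminus\{0\}$ with $\frac{qa}{e}\notin\Omega_q$, and suppose that $\left|\frac{qa}{de}\right|<1$ or that the ${}_3\phi_2$ below terminates (that is, one of $\frac{qa}{bc},d,e$ lies in $\Omega_q$). Then both series below converge absolutely and $$ {}_7W_6^{1}\left(a;b,c,d,e;q,\frac{q^2a^2}{bcde}\right)=\frac{(qa,\frac{qa}{de};q)_\infty}{(\frac{qa}{d},\frac{qa}{e};q)_\infty}\;{}_3\phi_2\left({\frac{qa}{bc},d,e\atop \frac{qa}{b},\frac{qa}{c}};q,\frac{qa}{de}\right). $$ (ii) Both series below converge absolutely and $$ {}_6W_5^{2}\left(a;b,c,d;q,\frac{q^2a^2}{bcd}\right)=\frac{(qa;q)_\infty}{(\frac{qa}{d};q)_\infty}\;{}_2\phi_2\left({\frac{qa}{bc},d\atop \frac{qa}{b},\frac{qa}{c}};q,\frac{qa}{d}\right). $$ If moreover $\left|\frac{qa}{bd}\right|<1$ or the ${}_2\phi_1$ below terminates (that is, $b\in\Omega_q$ or $d\in\Omega_q$),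 then the ${}_2\phi_1$ converges absolutely and both sides are also equal to $$ \frac{(qa,\frac{qa}{bd};q)_\infty}{(\frac{qa}{b},\frac{qa}{d};q)_\infty}\;{}_2\phi_1\left({b,d\atop \frac{qa}{c}};q,\frac{qa}{bd}\right). $$ -/

import Mathlib

/-- The set `Ω_q = {q^{-k} : k = 0, 1, 2, …}`. -/
def OmegaQ (q : ℂ) : Set ℂ := {x | ∃ k : ℕ, x = (q ^ k)⁻¹}

/-- The finite `q`-shifted factorial `(a;q)_n = (1-a)(1-aq)⋯(1-aq^{n-1})`. -/
noncomputable def qPoch (a q : ℂ) (n : ℕ) : ℂ := ∏ j ∈ Finset.range n, (1 - a * q ^ j)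

/-- The infinite `q`-shifted factorial `(a;q)_∞` (used for `|q| < 1`). -/
noncomputable def qPochInf (a q : ℂ) : ℂ := ∏' j : ℕ, (1 - a * q ^ j)

/-- For `|q| < 1` the infinite `q`-shifted factorial is the limit of the finite ones. -/
theorem tendsto_qPoch (a q : ℂ) (hq : ‖q‖ < 1) :
    Filter.Tendsto (qPoch a q) Filter.atTop (nhds (qPochInf a q)) := by
  have hs : Summable fun j : ℕ => ‖-(a * q ^ j)‖ := by
    simpa [norm_mul, norm_pow] using
      (summable_geometric_of_lt_one (norm_nonneg q) hq).mul_left ‖a‖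
  have hm : Multipliable fun j : ℕ => 1 + -(a * q ^ j) :=
    multipliable_one_add_of_summable hs
  have h := hm.hasProd.tendsto_prod_nat
  simp only [← sub_eq_add_neg] at h
  exact h

/-- The product `(a_1,…,a_r;q)_n = (a_1;q)_n ⋯ (a_r;q)_n`. -/
noncomputable def qPochList (as : List ℂ) (q : ℂ) (n : ℕ) : ℂ :=
  (as.map fun a => qPoch a q n).prod

/-- The product `(a_1,…,a_r;q)_∞ = (a_1;q)_∞ ⋯ (a_r;q)_∞`. -/
noncomputable def qPochInfList (as : List ℂ) (q : ℂ) : ℂ :=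
  (as.map fun a => qPochInf a q).prod

/-- The `k`-th term of the basic hypergeometric series `_rφ_s(as; bs; q, z)`,
where `r` and `s` are the lengths of the lists `as` and `bs`. -/
noncomputable def phiTerm (as bs : List ℂ) (q z : ℂ) (k : ℕ) : ℂ :=
  qPochList as q k / (qPoch q q k * qPochList bs q k)
    * ((-1) ^ k * q ^ k.choose 2) ^ (1 + (bs.length : ℤ) - (as.length : ℤ)) * z ^ k

/-- The basic hypergeometric series `_rφ_s(as; bs; q, z)`. -/
noncomputable def phi (as bs : List ℂ) (q z : ℂ) : ℂ := ∑' k : ℕ, phiTerm as bs q z k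

/-- The numerator parameters of `_{r+1}φ_s^p`: `-p` zeros are added if `p < 0`. -/
def zeroNum (p : ℤ) (as : List ℂ) : List ℂ := as ++ List.replicate (-p).toNat 0

/-- The denominator parameters of `_{r+1}φ_s^p`: `p` zeros are added if `p > 0`. -/
def zeroDen (p : ℤ) (bs : List ℂ) : List ℂ := bs ++ List.replicate p.toNat 0

/-- The numerator parameters `a, q√a, -q√a, a_4, …, a_{r+1}` of a very-well-poised series. -/
noncomputable def vwpNum (a : ℂ) (as : List ℂ) (q : ℂ) : List ℂ :=
  [a, q * a.sqrt, -(q * a.sqrt)] ++ as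

/-- The denominator parameters `√a, -√a, qa/a_4, …, qa/a_{r+1}` of a very-well-poised series. -/
noncomputable def vwpDen (a : ℂ) (as : List ℂ) (q : ℂ) : List ℂ :=
  [a.sqrt, -a.sqrt] ++ as.map fun x => q * a / x

/-- The `k`-th term of `_{r+1}W_r^p(a; a_4, …, a_{r+1}; q, z)`. -/
noncomputable def vwpTerm (p : ℤ) (a : ℂ) (as : List ℂ) (q z : ℂ) (k : ℕ) : ℂ :=
  phiTerm (zeroNum p (vwpNum a as q)) (zeroDen p (vwpDen a as q)) q z k

/-- The very-well-poised series `_{r+1}W_r^p(a; a_4, …, a_{r+1}; q, z)` with `p` vanishing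
denominator parameters; here `as = [a_4, …, a_{r+1}]`. -/
noncomputable def vwp (p : ℤ) (a : ℂ) (as : List ℂ) (q z : ℂ) : ℂ :=
  ∑' k : ℕ, vwpTerm p a as q z k

open Filter Topology

/-! Put `x = 1/e` and multiply (i) by `(qax;q)_∞`. Since `e⁻ᵏ (e;q)_k = ∏_{j<k} (x - q^j)` is a
polynomial in `x`, both sides become analytic in `x`. The left side `vwpEntire` is entire, because
its coefficients decay like `q^(k choose 2)`. The right side `phiProd` is analytic on the disc
`|qax/d| < 1`, and everywhere if the series terminates through `qa/(bc)` or `d`.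

At `x = q^N` all series are finite sums and the identity is a terminating Watson transformation
(`watson_terminating`). These points accumulate at `0`, so the identity theorem gives equality on
the whole domain. Then `x = 1/e` is (i), and `x = 0`, the limit `e → ∞`, is the `₂φ₂` formula of
(ii). If the `₃φ₂` terminates only through `e`, then `x` is itself some `q^N` and no continuation is
needed.

The terminating transformation follows Bailey's method: `sum_vwp_bailey` expands the `n`-th
coefficient `(qa/(bc))_n / ((qa/b)_n (qa/c)_n)` as a very-well-poised sum over `r ≤ n`; after
interchanging the sums, the inner sum is `qVandermonde`. Both summations are inductions driven by
the `q`-Pascal rules.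

For the `₂φ₁`, the very-well-poised series is symmetric in its parameters `b, c, d, e`. Applying (i)
with `1/x` in the place of `c` instead of `e`, and letting `x → 0`, gives a second value for
`vwpEntire` at `0`. -/

theorem qPoch_zero (a q : ℂ) : qPoch a q 0 = 1 := by simp [qPoch]

theorem qPoch_succ (a q : ℂ) (n : ℕ) : qPoch a q (n + 1) = qPoch a q n * (1 - a * q ^ n) := by
  simp [qPoch, Finset.prod_range_succ]

theorem qPoch_add (a q : ℂ) (m n : ℕ) :
    qPoch a q (m + n) = qPoch a q m * qPoch (a * q ^ m) q n := by
  simp only [qPoch, Finset.prod_range_add]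
  congr 1
  exact Finset.prod_congr rfl fun j _ => by ring

theorem qPoch_succ' (a q : ℂ) (n : ℕ) : qPoch a q (n + 1) = (1 - a) * qPoch (a * q) q n := by
  rw [add_comm, qPoch_add]; simp [qPoch]

theorem qPoch_ne_zero {a q : ℂ} (n : ℕ) (h : ∀ j < n, a * q ^ j ≠ 1) : qPoch a q n ≠ 0 :=
  Finset.prod_ne_zero_iff.2 fun j hj => sub_ne_zero.2 (h j (Finset.mem_range.1 hj)).symm

/-! ### Gaussian binomial coefficients. -/

/-- The Gaussian binomial coefficient, defined by the `q`-Pascal rule. -/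
noncomputable def qBinom (q : ℂ) : ℕ → ℕ → ℂ
  | _, 0 => 1
  | 0, _ + 1 => 0
  | n + 1, k + 1 => q ^ (k + 1) * qBinom q n (k + 1) + qBinom q n k

theorem qBinom_zero_right (q : ℂ) (n : ℕ) : qBinom q n 0 = 1 := by cases n <;> simp [qBinom]

theorem qBinom_succ_succ (q : ℂ) (n k : ℕ) :
    qBinom q (n + 1) (k + 1) = q ^ (k + 1) * qBinom q n (k + 1) + qBinom q n k := by
  simp [qBinom]

theorem qBinom_eq_zero_of_lt (q : ℂ) {n k : ℕ} (h : n < k) : qBinom q n k = 0 := by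
  induction n generalizing k with
  | zero => obtain ⟨k, rfl⟩ := Nat.exists_eq_succ_of_ne_zero h.ne'; simp [qBinom]
  | succ n ih =>
    obtain ⟨k, rfl⟩ := Nat.exists_eq_succ_of_ne_zero (Nat.ne_zero_of_lt h)
    rw [Nat.succ_eq_add_one, qBinom_succ_succ, ih (by omega), ih (by omega)]; simp

theorem qBinom_self (q : ℂ) (n : ℕ) : qBinom q n n = 1 := by
  induction n with
  | zero => simp [qBinom]
  | succ n ih => rw [qBinom_succ_succ, qBinom_eq_zero_of_lt q (Nat.lt_succ_self n), ih]; simp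

/-- The factorial formula without division, so that it holds for every `q`, roots of unity included.
-/
theorem qBinom_mul_qPoch (q : ℂ) (k m : ℕ) :
    qBinom q (k + m) k * (qPoch q q k * qPoch q q m) = qPoch q q (k + m) := by
  induction hn : k + m generalizing k m with
  | zero =>
    obtain ⟨rfl, rfl⟩ : k = 0 ∧ m = 0 := by omega
    simp [qBinom, qPoch_zero]
  | succ n ih =>
    rcases k with _ | k
    · obtain rfl : m = n + 1 := by omega
      simp [qBinom_zero_right, qPoch_zero]
    rcases m with _ | m
    · obtain rfl : k = n := by omega
      simp [qBinom_self, qPoch_zero]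
    have h1 := ih (k + 1) m (by omega)
    have h2 := ih k (m + 1) (by omega)
    obtain rfl : n = k + m + 1 := by omega
    rw [qBinom_succ_succ, qPoch_succ q q (k + m + 1), qPoch_succ q q m, qPoch_succ q q k]
    rw [qPoch_succ q q k] at h1
    rw [qPoch_succ q q m] at h2
    linear_combination q ^ (k + 1) * (1 - q * q ^ m) * h1 + (1 - q * q ^ k) * h2

/-- The second `q`-Pascal rule. -/
theorem qBinom_succ_succ' (q : ℂ) (k m : ℕ) :
    qBinom q (k + m + 1) (k + 1) = qBinom q (k + m) (k + 1) + q ^ m * qBinom q (k + m) k := by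
  induction hn : k + m generalizing k m with
  | zero =>
    obtain ⟨rfl, rfl⟩ : k = 0 ∧ m = 0 := by omega
    simp [qBinom]
  | succ n ih =>
    rcases k with _ | k
    · obtain rfl : m = n + 1 := by omega
      have h := ih 0 n (by omega)
      rw [qBinom_zero_right] at *
      rw [qBinom_succ_succ, qBinom_zero_right, qBinom_succ_succ q n, qBinom_zero_right]
      rw [qBinom_succ_succ, qBinom_zero_right] at h
      simp only [zero_add] at h ⊢
      linear_combination q * h
    rcases m with _ | m
    · obtain rfl : k = n := by omega
      simp [qBinom_self, qBinom_eq_zero_of_lt]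
    have h1 := ih (k + 1) m (by omega)
    have h2 := ih k (m + 1) (by omega)
    have p1 := qBinom_succ_succ q n (k + 1)
    have p2 := qBinom_succ_succ q n k
    rw [qBinom_succ_succ]
    linear_combination q ^ (k + 2) * h1 + h2 - p1 - q ^ (m + 1) * p2

/-- Both products are the multinomial `(q)_{r+m+l} / ((q)_r (q)_m (q)_l)`. -/
theorem qBinom_mul_qBinom {q : ℂ} (hq : ∀ n, qPoch q q n ≠ 0) (r m l : ℕ) :
    qBinom q (r + m + l) (r + m) * qBinom q (r + m) r =
      qBinom q (r + (m + l)) r * qBinom q (m + l) m := by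
  have h1 := qBinom_mul_qPoch q (r + m) l
  have h2 := qBinom_mul_qPoch q r m
  have h3 := qBinom_mul_qPoch q r (m + l)
  have h4 := qBinom_mul_qPoch q m l
  rw [← add_assoc] at h3 ⊢
  apply mul_right_cancel₀ (mul_ne_zero (mul_ne_zero (hq r) (hq m)) (hq l))
  linear_combination (qBinom q (r + m + l) (r + m) * qPoch q q l) * h2 + h1 - h3 -
    (qBinom q (r + m + l) r * qPoch q q r) * h4

/-- The induction step shared by both terminating summations: a weighted Pascal rule lowers `n + 1`
to `n` at the price of replacing `F` by a combination of `F r` and `F (r + 1)`. -/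
theorem sum_qBinom_succ (q s : ℂ) (n : ℕ) (F x y : ℕ → ℂ)
    (h0 : s = x 0)
    (h : ∀ r ≤ n, s * qBinom q (n + 1) (r + 1) = x (r + 1) * qBinom q n (r + 1) + y r * qBinom q n r) :
    s * ∑ r ∈ Finset.range (n + 2), qBinom q (n + 1) r * F r =
      ∑ r ∈ Finset.range (n + 1), qBinom q n r * (x r * F r + y r * F (r + 1)) := by
  have e1 : ∑ r ∈ Finset.range (n + 1), qBinom q n r * (x r * F r) =
      ∑ r ∈ Finset.range (n + 1), qBinom q n (r + 1) * (x (r + 1) * F (r + 1)) + x 0 * F 0 := by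
    have := Finset.sum_range_succ (fun r => qBinom q n r * (x r * F r)) (n + 1)
    rw [Finset.sum_range_succ', qBinom_eq_zero_of_lt q (Nat.lt_succ_self n),
      qBinom_zero_right] at this
    linear_combination -this
  simp only [mul_add, Finset.sum_add_distrib] at e1 ⊢
  rw [e1, Finset.sum_range_succ', mul_add, qBinom_zero_right, Finset.mul_sum, h0]
  rw [add_right_comm, ← Finset.sum_add_distrib, one_mul, ← h0]
  congr 1
  refine Finset.sum_congr rfl fun r hr => ?_
  linear_combination F (r + 1) * h r (by simpa [Nat.lt_succ_iff] using hr)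

/-! ### Terminating summations and Watson's transformation. -/

/-- The `q`-Chu–Vandermonde sum. -/
theorem qVandermonde (q D E : ℂ) (M : ℕ) (h : ∀ j, D * E * q ^ j ≠ 1) :
    ∑ m ∈ Finset.range (M + 1), qBinom q M m *
      ((-1) ^ m * q ^ m.choose 2 * (qPoch D q m / qPoch (D * E) q m) * E ^ m) =
      qPoch E q M / qPoch (D * E) q M := by
  induction M generalizing E with
  | zero => simp [qBinom, qPoch_zero]
  | succ M ih =>
    have h' : ∀ j, D * (E * q) * q ^ j ≠ 1 := fun j => by
      have := h (j + 1); rwa [pow_succ', ← mul_assoc, mul_assoc D] at this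
    have h0 : 1 - D * E ≠ 0 := sub_ne_zero.2 (by simpa using (h 0).symm)
    -- With these weights, `q^m F m + F (m+1)` is `(1 - E)/(1 - DE)` times the `m`-th summand for `E
    -- q`, so the induction hypothesis applies.
    have key := sum_qBinom_succ q 1 M (fun m => (-1) ^ m * q ^ m.choose 2 *
      (qPoch D q m / qPoch (D * E) q m) * E ^ m) (fun m => q ^ m) (fun _ => 1) (by simp)
      (fun r _ => by rw [qBinom_succ_succ]; ring)
    rw [one_mul] at key
    rw [key, qPoch_succ', qPoch_succ', mul_assoc D, mul_div_mul_comm, ← ih _ h', Finset.mul_sum]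
    refine Finset.sum_congr rfl fun m _ => ?_
    have e1 : qPoch (D * E) q (m + 1) = (1 - D * E) * qPoch (D * (E * q)) q m := by
      rw [qPoch_succ', mul_assoc D]
    have e2 : qPoch (D * E) q m ≠ 0 := qPoch_ne_zero _ fun j _ => h j
    have e3 : qPoch (D * (E * q)) q m ≠ 0 := qPoch_ne_zero _ fun j _ => h' j
    have e4 : 1 - D * E * q ^ m ≠ 0 := sub_ne_zero.2 (h m).symm
    have e5 : qPoch (D * (E * q)) q m = qPoch (D * E) q m * (1 - D * E * q ^ m) / (1 - D * E) := by
      rw [eq_div_iff h0, ← qPoch_succ, e1]; ring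
    have e6 : (m + 1).choose 2 = m + m.choose 2 := by
      rw [Nat.choose_succ_succ]; simp
    rw [e5, qPoch_succ, qPoch_succ, e6]
    generalize hv : 1 - D * E * q ^ m = v at *
    field_simp
    rw [← hv]
    ring

/-- The terminating very-well-poised `₆φ₅` sum, in the form of a Bailey pair. -/
theorem sum_vwp_bailey {q : ℂ} (hq0 : q ≠ 0) (n : ℕ) : ∀ (a b c : ℂ), b ≠ 0 → c ≠ 0 →
    (∀ j, a * q ^ j ≠ 1) → (∀ j, a * q / b * q ^ j ≠ 1) → (∀ j, a * q / c * q ^ j ≠ 1) →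
    ∑ r ∈ Finset.range (n + 1), qBinom q n r *
      ((-1) ^ r * q ^ r.choose 2 * ((1 - a * q ^ (2 * r)) / qPoch (a * q ^ r) q (n + 1)) *
        (qPoch b q r * qPoch c q r / (qPoch (a * q / b) q r * qPoch (a * q / c) q r)) *
        (a * q / (b * c)) ^ r) =
      qPoch (a * q / (b * c)) q n / (qPoch (a * q / b) q n * qPoch (a * q / c) q n) := by
  induction n with
  | zero =>
    intro a b c _ _ h _ _
    have h0 : 1 - a ≠ 0 := sub_ne_zero.2 (by simpa using (h 0).symm)
    simp [qBinom, qPoch, h0]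
  | succ n ih =>
    intro a b c hb hc h hB hC
    have h1 := ih a b c hb hc h hB hC
    have sB : a * q ^ 2 * q / (b * q) = a * q / b * q := by field_simp
    have sC : a * q ^ 2 * q / (c * q) = a * q / c * q := by field_simp
    have sBC : a * q ^ 2 * q / (b * q * (c * q)) = a * q / (b * c) := by field_simp
    have h2 := ih (a * q ^ 2) (b * q) (c * q) (mul_ne_zero hb hq0) (mul_ne_zero hc hq0)
      (fun j => by have := h (j + 2); rwa [pow_add, mul_comm (q ^ j), ← mul_assoc] at this)
      (fun j => by rw [sB]; have := hB (j + 1); rwa [pow_succ', ← mul_assoc] at this)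
      (fun j => by rw [sC]; have := hC (j + 1); rwa [pow_succ', ← mul_assoc] at this)
    rw [sB, sC, sBC] at h2
    have n1 : 1 - a * q ^ (n + 1) ≠ 0 := sub_ne_zero.2 (h _).symm
    have nB (j) : 1 - a * q / b * q ^ j ≠ 0 := sub_ne_zero.2 (hB j).symm
    have nC (j) : 1 - a * q / c * q ^ j ≠ 0 := sub_ne_zero.2 (hC j).symm
    have nB0 : 1 - a * q / b ≠ 0 := by simpa using nB 0
    have nC0 : 1 - a * q / c ≠ 0 := by simpa using nC 0
    -- The weights come from subtracting `a q^(n+1)` times the first Pascal rule from the second.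
    -- The `F r` part then gives the sum for `(a, b, c)`, and the `F (r+1)` part a multiple of the
    -- sum for `(a q², b q, c q)`.
    have key := sum_qBinom_succ q (1 - a * q ^ (n + 1)) n
      (fun r => ((-1) ^ r * q ^ r.choose 2 * ((1 - a * q ^ (2 * r)) / qPoch (a * q ^ r) q (n + 2)) *
        (qPoch b q r * qPoch c q r / (qPoch (a * q / b) q r * qPoch (a * q / c) q r)) *
        (a * q / (b * c)) ^ r)) (fun r => 1 - a * q ^ (n + r + 1))
      (fun r => q ^ (n - r) * (1 - a * q ^ (r + 1))) (by simp)
      (fun r hr => by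
        obtain ⟨m, rfl⟩ := Nat.exists_eq_add_of_le hr
        have p1 := qBinom_succ_succ q (r + m) r
        have p2 := qBinom_succ_succ' q r m
        rw [Nat.add_sub_cancel_left]
        linear_combination p2 - a * q ^ (r + m + 1) * p1)
    apply mul_left_cancel₀ n1
    rw [key]
    have tgt : (1 - a * q ^ (n + 1)) * (qPoch (a * q / (b * c)) q (n + 1) /
        (qPoch (a * q / b) q (n + 1) * qPoch (a * q / c) q (n + 1))) =
        qPoch (a * q / (b * c)) q n / (qPoch (a * q / b) q n * qPoch (a * q / c) q n) +
        -(q ^ n * (a * q / (b * c)) * ((1 - b) * (1 - c) / ((1 - a * q / b) * (1 - a * q / c)))) *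
        (qPoch (a * q / (b * c)) q n / (qPoch (a * q / b * q) q n * qPoch (a * q / c * q) q n)) := by
      have eB : qPoch (a * q / b * q) q n = qPoch (a * q / b) q n * (1 - a * q / b * q ^ n) /
          (1 - a * q / b) := by
        rw [eq_div_iff nB0, ← qPoch_succ, qPoch_succ']; ring
      have eC : qPoch (a * q / c * q) q n = qPoch (a * q / c) q n * (1 - a * q / c * q ^ n) /
          (1 - a * q / c) := by
        rw [eq_div_iff nC0, ← qPoch_succ, qPoch_succ']; ring
      have zB : qPoch (a * q / b) q n ≠ 0 := qPoch_ne_zero _ fun j _ => hB j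
      have zC : qPoch (a * q / c) q n ≠ 0 := qPoch_ne_zero _ fun j _ => hC j
      rw [eB, eC, qPoch_succ, qPoch_succ, qPoch_succ]
      have zB' := nB n
      have zC' := nC n
      generalize qPoch (a * q / b) q n = X at *
      generalize qPoch (a * q / c) q n = Y at *
      generalize qPoch (a * q / (b * c)) q n = Z at *
      have iden : (1 - a * q ^ (n + 1)) * (1 - a * q / (b * c) * q ^ n) =
        (1 - a * q / b * q ^ n) * (1 - a * q / c * q ^ n) -
          q ^ n * (a * q / (b * c)) * ((1 - b) * (1 - c)) := by
        field_simp; ring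
      generalize 1 - a * q / b * q ^ n = u at *
      generalize 1 - a * q / c * q ^ n = v at *
      generalize 1 - a * q / b  = s at *
      generalize 1 - a * q / c  = t at *
      generalize a * q / (b * c) = w at *
      field_simp
      linear_combination Z * iden
    rw [tgt, ← h1, ← h2, Finset.mul_sum, ← Finset.sum_add_distrib]
    refine Finset.sum_congr rfl fun r hr => ?_
    obtain ⟨m, rfl⟩ := Nat.exists_eq_add_of_le (Nat.lt_succ_iff.1 (Finset.mem_range.1 hr))
    have e6 : (r + 1).choose 2 = r + r.choose 2 := by
      rw [Nat.choose_succ_succ]; simp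
    have a1 : qPoch (a * q ^ r) q (r + m + 2) =
        qPoch (a * q ^ r) q (r + m + 1) * (1 - a * q ^ (r + m + r + 1)) := by
      rw [qPoch_succ]; ring
    have a2 : qPoch (a * q ^ (r + 1)) q (r + m + 2) =
        (1 - a * q ^ (r + 1)) * qPoch (a * q ^ 2 * q ^ r) q (r + m + 1) := by
      rw [qPoch_succ']; ring_nf
    have z1 : qPoch (a * q ^ r) q (r + m + 1) ≠ 0 :=
      qPoch_ne_zero _ fun j _ => by rw [mul_assoc, ← pow_add]; exact h _
    have z2 : qPoch (a * q ^ 2 * q ^ r) q (r + m + 1) ≠ 0 :=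
      qPoch_ne_zero _ fun j _ => by rw [mul_assoc, mul_assoc, ← pow_add, ← pow_add]; exact h _
    have z3 : 1 - a * q ^ (r + m + r + 1) ≠ 0 := sub_ne_zero.2 (h _).symm
    have z4 : 1 - a * q ^ (r + 1) ≠ 0 := sub_ne_zero.2 (h _).symm
    have zB : qPoch (a * q / b * q) q r ≠ 0 :=
      qPoch_ne_zero _ fun j _ => by rw [mul_assoc, ← pow_succ']; exact hB _
    have zC : qPoch (a * q / c * q) q r ≠ 0 :=
      qPoch_ne_zero _ fun j _ => by rw [mul_assoc, ← pow_succ']; exact hC _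
    have zB' : qPoch (a * q / b) q r ≠ 0 := qPoch_ne_zero _ fun j _ => hB j
    have zC' : qPoch (a * q / c) q r ≠ 0 := qPoch_ne_zero _ fun j _ => hC j
    rw [Nat.add_sub_cancel_left, mul_add]
    congr 1
    · rw [a1]
      field_simp
    · rw [a2, e6, qPoch_succ' b, qPoch_succ' c, qPoch_succ' (a * q / b), qPoch_succ' (a * q / c)]
      generalize qPoch (a * q / b * q) q r = X at *
      generalize qPoch (a * q / c * q) q r = Y at *
      generalize 1 - a * q / b  = s at *
      generalize 1 - a * q / c  = t at *
      generalize a * q / (b * c) = w at *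
      field_simp
      ring

theorem qPoch_self_ne_zero {q : ℂ} (hq1 : ‖q‖ < 1) (n : ℕ) : qPoch q q n ≠ 0 :=
  qPoch_ne_zero _ fun j _ h => by
    have h1 : ‖q‖ ^ (j + 1) = 1 := by rw [← norm_pow, pow_succ', h, norm_one]
    exact absurd h1 (pow_lt_one₀ (norm_nonneg q) hq1 (Nat.succ_ne_zero j)).ne

theorem choose_two_add (r m : ℕ) : (r + m).choose 2 = r.choose 2 + m.choose 2 + r * m := by
  induction m with
  | zero => simp
  | succ m ih =>
    rw [← add_assoc, Nat.choose_succ_succ, Nat.choose_succ_succ m, ih]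
    simp
    ring

/-- The limiting case of Watson's transformation with a terminating parameter `q⁻ᴺ`, when `a` is
generic. -/
theorem watson_terminating_of_generic {q a b c d : ℂ} (hq0 : q ≠ 0) (hq1 : ‖q‖ < 1)
    (hb : b ≠ 0) (hc : c ≠ 0) (hd : d ≠ 0) (h : ∀ j, a * q ^ j ≠ 1)
    (hB : ∀ j, q * a / b * q ^ j ≠ 1) (hC : ∀ j, q * a / c * q ^ j ≠ 1)
    (hD : ∀ j, q * a / d * q ^ j ≠ 1) (N : ℕ) :
    (1 - a) * (qPoch (q * a) q N / qPoch (q * a / d) q N) * ∑ n ∈ Finset.range (N + 1),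
      qBinom q N n * ((-1) ^ n * q ^ n.choose 2 * (qPoch (q * a / (b * c)) q n * qPoch d q n /
        (qPoch (q * a / b) q n * qPoch (q * a / c) q n)) * (q * a / d) ^ n) =
    ∑ r ∈ Finset.range (N + 1), qBinom q N r * ((q ^ r.choose 2) ^ 2 * (1 - a * q ^ (2 * r)) *
      (qPoch a q r * qPoch b q r * qPoch c q r * qPoch d q r / (qPoch (q * a / b) q r *
        qPoch (q * a / c) q r * qPoch (q * a / d) q r * qPoch (q * a * q ^ N) q r)) *
      (q ^ 2 * a ^ 2 / (b * c * d)) ^ r) := by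
  have hA (n : ℕ) := sum_vwp_bailey hq0 n a b c hb hc h
    (by simpa only [mul_comm a q] using hB) (by simpa only [mul_comm a q] using hC)
  simp only [mul_comm a q] at hA
  have step : ∀ n ∈ Finset.range (N + 1), qBinom q N n * ((-1) ^ n * q ^ n.choose 2 *
      (qPoch (q * a / (b * c)) q n * qPoch d q n /
        (qPoch (q * a / b) q n * qPoch (q * a / c) q n)) * (q * a / d) ^ n) =
      ∑ r ∈ Finset.range (n + 1), qBinom q N n * ((-1) ^ n * q ^ n.choose 2 * qPoch d q n *
        (q * a / d) ^ n) * (qBinom q n r *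
      ((-1) ^ r * q ^ r.choose 2 * ((1 - a * q ^ (2 * r)) / qPoch (a * q ^ r) q (n + 1)) *
        (qPoch b q r * qPoch c q r / (qPoch (q * a / b) q r * qPoch (q * a / c) q r)) *
        (q * a / (b * c)) ^ r)) := fun n _ => by
    rw [← Finset.mul_sum, hA n]; ring
  -- Interchange of summation over the triangle `r ≤ n ≤ N`.
  rw [Finset.sum_congr rfl step, Finset.sum_comm' (t' := Finset.range (N + 1))
    (s' := fun r => Finset.Ico r (N + 1)) (by intro x y; simp; omega), Finset.mul_sum]
  refine Finset.sum_congr rfl fun r hr => ?_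
  obtain ⟨M, rfl⟩ := Nat.exists_eq_add_of_le (Nat.lt_succ_iff.1 (Finset.mem_range.1 hr))
  have n0 : 1 - a ≠ 0 := sub_ne_zero.2 (by simpa using (h 0).symm)
  have hDE : d * q ^ r * (q * a / d * q ^ r) = a * q ^ (2 * r + 1) := by field_simp; ring
  -- With `n = r + m`, the factor `q^(r m)` from `(r+m).choose 2` turns `(qa/d)^m` into `E^m`,
  -- whence this `E`.
  have hV := qVandermonde q (d * q ^ r) (q * a / d * q ^ r) M
    (fun j => by rw [hDE, mul_assoc, ← pow_add]; exact h _)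
  rw [hDE] at hV
  have zr (i n : ℕ) : qPoch (a * q ^ i) q n ≠ 0 :=
    qPoch_ne_zero _ fun j _ => by rw [mul_assoc, ← pow_add]; exact h _
  have zB : qPoch (q * a / b) q r ≠ 0 := qPoch_ne_zero _ fun j _ => hB j
  have zC : qPoch (q * a / c) q r ≠ 0 := qPoch_ne_zero _ fun j _ => hC j
  have zD : qPoch (q * a / d) q r ≠ 0 := qPoch_ne_zero _ fun j _ => hD j
  have zD' : qPoch (q * a / d * q ^ r) q M ≠ 0 :=
    qPoch_ne_zero _ fun j _ => by rw [mul_assoc, ← pow_add]; exact hD _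
  have inner : ∑ n ∈ Finset.Ico r (r + M + 1), qBinom q (r + M) n *
      ((-1) ^ n * q ^ n.choose 2 * qPoch d q n * (q * a / d) ^ n) * (qBinom q n r *
      ((-1) ^ r * q ^ r.choose 2 * ((1 - a * q ^ (2 * r)) / qPoch (a * q ^ r) q (n + 1)) *
        (qPoch b q r * qPoch c q r / (qPoch (q * a / b) q r * qPoch (q * a / c) q r)) *
        (q * a / (b * c)) ^ r)) =
      qBinom q (r + M) r * ((q ^ r.choose 2) ^ 2 * (1 - a * q ^ (2 * r)) *
      (qPoch b q r * qPoch c q r * qPoch d q r / (qPoch (q * a / b) q r *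
        qPoch (q * a / c) q r * qPoch (a * q ^ r) q (r + 1))) *
      (q ^ 2 * a ^ 2 / (b * c * d)) ^ r) * (qPoch (q * a / d * q ^ r) q M /
        qPoch (a * q ^ (2 * r + 1)) q M) := by
    rw [← hV, Finset.mul_sum, Finset.sum_Ico_eq_sum_range,
      show r + M + 1 - r = M + 1 by omega]
    refine Finset.sum_congr rfl fun m hm => ?_
    obtain ⟨l, rfl⟩ := Nat.exists_eq_add_of_le (Nat.lt_succ_iff.1 (Finset.mem_range.1 hm))
    have b1 := qBinom_mul_qBinom (qPoch_self_ne_zero hq1) r m l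
    have p1 : qPoch (a * q ^ r) q (r + m + 1) =
        qPoch (a * q ^ r) q (r + 1) * qPoch (a * q ^ (2 * r + 1)) q m := by
      rw [show r + m + 1 = r + 1 + m by ring, qPoch_add]
      congr 2; ring
    have c1 : (r + m).choose 2 = r.choose 2 + m.choose 2 + r * m := by
      exact choose_two_add r m
    have w1 : (q ^ 2 * a ^ 2 / (b * c * d)) ^ r = (q * a / d) ^ r * (q * a / (b * c)) ^ r := by
      rw [← mul_pow (q * a / d)]; congr 1; field_simp
    have s1 : ((-1 : ℂ) ^ r) * (-1) ^ r = 1 := by rw [← mul_pow]; simp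
    rw [p1, qPoch_add d, c1, w1, ← add_assoc] at *
    rw [add_assoc r m l] at *
    have z1 := zr r (r + 1)
    have z2 := zr (2 * r + 1) m
    rw [mul_pow (q * a / d)]
    generalize q * a / d = w at *
    generalize q * a / (b * c) = w' at *
    calc _ = (qBinom q (r + (m + l)) (r + m) * qBinom q (r + m) r) * (((-1 : ℂ) ^ r) * (-1) ^ r) *
        ((-1) ^ m * q ^ (r.choose 2 + m.choose 2 + r * m) * (qPoch d q r * qPoch (d * q ^ r) q m) * w ^ (r + m)
        * q ^ r.choose 2 * ((1 - a * q ^ (2 * r)) / (qPoch (a * q ^ r) q (r + 1) * qPoch (a * q ^ (2 * r + 1)) q m)) *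
        (qPoch b q r * qPoch c q r / (qPoch (q * a / b) q r * qPoch (q * a / c) q r)) *
        w' ^ r) := by ring
      _ = _ := by
        rw [b1, s1]
        ring
  rw [inner]
  have t1 : qPoch (q * a / d) q (r + M) = qPoch (q * a / d) q r * qPoch (q * a / d * q ^ r) q M :=
    qPoch_add _ _ _ _
  -- Both sides are `(a;q)_{2r+M+1}`.
  have t2 : qPoch a q r * (qPoch (a * q ^ r) q (r + 1) * qPoch (a * q ^ (2 * r + 1)) q M) =
      (1 - a) * qPoch (q * a) q (r + M) * qPoch (q * a * q ^ (r + M)) q r := by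
    rw [mul_comm q a, ← qPoch_succ', mul_assoc a q, ← pow_succ', ← qPoch_add,
      show a * q ^ (2 * r + 1) = a * q ^ r * q ^ (r + 1) by ring, ← qPoch_add, ← qPoch_add]
    congr 1; ring
  have z1 := zr r (r + 1)
  have z2 := zr (2 * r + 1) M
  have z3 : qPoch (q * a * q ^ (r + M)) q r ≠ 0 := by
    rw [mul_comm q, mul_assoc, ← pow_succ']; exact zr _ _
  have z4 : qPoch a q r ≠ 0 := by simpa using zr 0 r
  rw [t1]
  have t3 : (1 - a) * qPoch (q * a) q (r + M) = qPoch a q r * (qPoch (a * q ^ r) q (r + 1) *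
      qPoch (a * q ^ (2 * r + 1)) q M) / qPoch (q * a * q ^ (r + M)) q r := by
    rw [t2, mul_div_cancel_right₀ _ z3]
  rw [← mul_div_assoc, t3]
  generalize qPoch (q * a / b) q r = X at *
  generalize qPoch (q * a / c) q r = Y at *
  generalize qPoch (q * a / d) q r = Z at *
  generalize qPoch (q * a / d * q ^ r) q M = Z' at *
  generalize (q ^ 2 * a ^ 2 / (b * c * d)) ^ r = U at *
  field_simp

/-! ### Removing the genericity of `a` by continuity. -/

theorem mem_OmegaQ_iff {q x : ℂ} (hq0 : q ≠ 0) : x ∈ OmegaQ q ↔ ∃ j : ℕ, x * q ^ j = 1 := by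
  simp only [OmegaQ, Set.mem_ofPred_eq]
  exact exists_congr fun j => (mul_eq_one_iff_eq_inv₀ (pow_ne_zero j hq0)).symm

theorem notMem_OmegaQ_iff {q x : ℂ} (hq0 : q ≠ 0) : x ∉ OmegaQ q ↔ ∀ j : ℕ, x * q ^ j ≠ 1 := by
  rw [mem_OmegaQ_iff hq0]; push Not; rfl

theorem countable_OmegaQ (q : ℂ) : (OmegaQ q).Countable := by
  have : OmegaQ q = Set.range fun k : ℕ => (q ^ k)⁻¹ := by
    ext x; simp [OmegaQ, eq_comm]
  rw [this]; exact Set.countable_range _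

theorem continuous_qPoch (q : ℂ) (n : ℕ) : Continuous fun x => qPoch x q n := by
  unfold qPoch; fun_prop

/-- The Bailey sums divide by factors `1 - a q^j` that cancel in the final identity. Both sides are
continuous at `a`, and generic parameters are dense, so the identity persists when some such factor
vanishes. -/
theorem watson_terminating {q a b c d : ℂ} (hq0 : q ≠ 0) (hq1 : ‖q‖ < 1)
    (hb : b ≠ 0) (hc : c ≠ 0) (hd : d ≠ 0) (hB : q * a / b ∉ OmegaQ q)
    (hC : q * a / c ∉ OmegaQ q) (hD : q * a / d ∉ OmegaQ q) (N : ℕ)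
    (hN : q * a * q ^ N ∉ OmegaQ q) :
    (1 - a) * (qPoch (q * a) q N / qPoch (q * a / d) q N) * ∑ n ∈ Finset.range (N + 1),
      qBinom q N n * ((-1) ^ n * q ^ n.choose 2 * (qPoch (q * a / (b * c)) q n * qPoch d q n /
        (qPoch (q * a / b) q n * qPoch (q * a / c) q n)) * (q * a / d) ^ n) =
    ∑ r ∈ Finset.range (N + 1), qBinom q N r * ((q ^ r.choose 2) ^ 2 * (1 - a * q ^ (2 * r)) *
      (qPoch a q r * qPoch b q r * qPoch c q r * qPoch d q r / (qPoch (q * a / b) q r *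
        qPoch (q * a / c) q r * qPoch (q * a / d) q r * qPoch (q * a * q ^ N) q r)) *
      (q ^ 2 * a ^ 2 / (b * c * d)) ^ r) := by
  rw [notMem_OmegaQ_iff hq0] at hB hC hD hN
  -- The nongeneric parameters: those in `Ω_q`, or with `qa/b`, `qa/c` or `qa/d` in `Ω_q`.
  have hcount : (OmegaQ q ∪ ((fun x => b / q * x) '' OmegaQ q ∪ ((fun x => c / q * x) '' OmegaQ q ∪
      (fun x => d / q * x) '' OmegaQ q))).Countable :=
    (countable_OmegaQ q).union (((countable_OmegaQ q).image _).union
      (((countable_OmegaQ q).image _).union ((countable_OmegaQ q).image _)))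
  have hdense := hcount.dense_compl ℂ
  have hmem {a' y : ℂ} (hy : y ≠ 0) (h : a' ∉ (fun x => y / q * x) '' OmegaQ q) :
      ∀ j, q * a' / y * q ^ j ≠ 1 := by
    rw [← notMem_OmegaQ_iff hq0]
    exact fun h' => h ⟨_, h', by field_simp⟩
  have cP (f : ℂ → ℂ) (hf : ContinuousAt f a) (n : ℕ) : ContinuousAt (fun x => qPoch (f x) q n) a :=
    (continuous_qPoch q n).continuousAt.comp hf
  have nz {x : ℂ} (h : ∀ j, x * q ^ j ≠ 1) (n : ℕ) : qPoch x q n ≠ 0 :=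
    qPoch_ne_zero n fun j _ => h j
  have : (nhdsWithin a (OmegaQ q ∪ ((fun x => b / q * x) '' OmegaQ q ∪
      ((fun x => c / q * x) '' OmegaQ q ∪ (fun x => d / q * x) '' OmegaQ q)))ᶜ).NeBot :=
    mem_closure_iff_nhdsWithin_neBot.1 (hdense a)
  refine tendsto_nhds_unique_of_eventuallyEq
    (f := fun a => (1 - a) * (qPoch (q * a) q N / qPoch (q * a / d) q N) *
      ∑ n ∈ Finset.range (N + 1), qBinom q N n * ((-1) ^ n * q ^ n.choose 2 *
        (qPoch (q * a / (b * c)) q n * qPoch d q n /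
        (qPoch (q * a / b) q n * qPoch (q * a / c) q n)) * (q * a / d) ^ n))
    (g := fun a => ∑ r ∈ Finset.range (N + 1), qBinom q N r * ((q ^ r.choose 2) ^ 2 *
      (1 - a * q ^ (2 * r)) *
      (qPoch a q r * qPoch b q r * qPoch c q r * qPoch d q r / (qPoch (q * a / b) q r *
        qPoch (q * a / c) q r * qPoch (q * a / d) q r * qPoch (q * a * q ^ N) q r)) *
      (q ^ 2 * a ^ 2 / (b * c * d)) ^ r))
    (l := nhdsWithin a (OmegaQ q ∪ ((fun x => b / q * x) '' OmegaQ q ∪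
      ((fun x => c / q * x) '' OmegaQ q ∪ (fun x => d / q * x) '' OmegaQ q)))ᶜ)
    (ContinuousAt.tendsto (x := a) ?_ |>.mono_left nhdsWithin_le_nhds)
    (ContinuousAt.tendsto (x := a) ?_ |>.mono_left nhdsWithin_le_nhds) ?_
  · refine ContinuousAt.mul (ContinuousAt.mul (by fun_prop) (ContinuousAt.div
      (cP _ (by fun_prop) _) (cP _ (by fun_prop) _) (nz hD _))) ?_
    refine tendsto_finsetSum _ fun n _ => ContinuousAt.mul (by fun_prop) (ContinuousAt.mul
      (ContinuousAt.mul (by fun_prop) (ContinuousAt.div (ContinuousAt.mul (cP _ (by fun_prop) _)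
        (by fun_prop)) (ContinuousAt.mul (cP _ (by fun_prop) _) (cP _ (by fun_prop) _))
          (mul_ne_zero (nz hB _) (nz hC _)))) (by fun_prop))
  · refine tendsto_finsetSum _ fun n _ => ContinuousAt.mul (by fun_prop) (ContinuousAt.mul
      (ContinuousAt.mul (by fun_prop) (ContinuousAt.div ?_ ?_ ?_)) (by fun_prop))
    · exact (((cP _ (by fun_prop) _).mul (by fun_prop)).mul (by fun_prop)).mul (by fun_prop)
    · exact (((cP _ (by fun_prop) _).mul (cP _ (by fun_prop) _)).mul (cP _ (by fun_prop) _)).mul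
        (cP _ (by fun_prop) _)
    · exact mul_ne_zero (mul_ne_zero (mul_ne_zero (nz hB _) (nz hC _)) (nz hD _)) (nz hN _)
  · filter_upwards [self_mem_nhdsWithin] with x hx
    simp only [Set.mem_compl_iff, Set.mem_union, not_or] at hx
    exact watson_terminating_of_generic hq0 hq1 hb hc hd ((notMem_OmegaQ_iff hq0).1 hx.1)
      (hmem hb hx.2.1) (hmem hc hx.2.2.1) (hmem hd hx.2.2.2) N

/-! ### Uniform bounds and infinite products. -/

theorem prod_one_add_mul_pow_le_exp {t ρ : ℝ} (ht : 0 ≤ t) (hρ0 : 0 ≤ ρ) (hρ1 : ρ < 1) (n : ℕ) :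
    ∏ j ∈ Finset.range n, (1 + t * ρ ^ j) ≤ Real.exp (t * (1 - ρ)⁻¹) := by
  calc ∏ j ∈ Finset.range n, (1 + t * ρ ^ j) ≤ ∏ j ∈ Finset.range n, Real.exp (t * ρ ^ j) :=
        Finset.prod_le_prod (fun j _ => by positivity) fun j _ => by
          linarith [Real.add_one_le_exp (t * ρ ^ j)]
    _ = Real.exp (t * ∑ j ∈ Finset.range n, ρ ^ j) := by
        rw [← Real.exp_sum, Finset.mul_sum]
    _ ≤ _ := by
        gcongr
        exact sum_le_hasSum _ (fun j _ => by positivity) (hasSum_geometric_of_lt_one hρ0 hρ1)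

theorem norm_qPoch_le {q : ℂ} (hq1 : ‖q‖ < 1) {x : ℂ} {t : ℝ} (hx : ‖x‖ ≤ t) (n : ℕ) :
    ‖qPoch x q n‖ ≤ Real.exp (t * (1 - ‖q‖)⁻¹) := by
  have ht : 0 ≤ t := (norm_nonneg x).trans hx
  refine le_trans ?_ (prod_one_add_mul_pow_le_exp ht (norm_nonneg q) hq1 n)
  rw [qPoch, norm_prod]
  refine Finset.prod_le_prod (fun _ _ => norm_nonneg _) fun j _ => ?_
  refine (norm_sub_le _ _).trans ?_
  rw [norm_one, norm_mul, norm_pow]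
  gcongr

theorem norm_qPochInf_le {q : ℂ} (hq1 : ‖q‖ < 1) {x : ℂ} {t : ℝ} (hx : ‖x‖ ≤ t) :
    ‖qPochInf x q‖ ≤ Real.exp (t * (1 - ‖q‖)⁻¹) :=
  le_of_tendsto (tendsto_qPoch x q hq1).norm (Eventually.of_forall fun n => norm_qPoch_le hq1 hx n)

theorem summable_norm_mul_pow {q : ℂ} (hq1 : ‖q‖ < 1) (x : ℂ) :
    Summable fun j : ℕ => ‖-(x * q ^ j)‖ := by
  simpa [norm_mul, norm_pow] using
    (summable_geometric_of_lt_one (norm_nonneg q) hq1).mul_left ‖x‖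

theorem qPochInf_ne_zero {q x : ℂ} (hq0 : q ≠ 0) (hq1 : ‖q‖ < 1) (hx : x ∉ OmegaQ q) :
    qPochInf x q ≠ 0 := by
  have := tprod_one_add_ne_zero_of_summable (f := fun j : ℕ => -(x * q ^ j)) (fun j => by
    rw [← sub_eq_add_neg]; exact sub_ne_zero.2 ((notMem_OmegaQ_iff hq0).1 hx j).symm)
    (summable_norm_mul_pow hq1 x)
  simpa only [qPochInf, ← sub_eq_add_neg] using this

theorem qPochInf_eq_mul {q : ℂ} (hq1 : ‖q‖ < 1) (x : ℂ) (n : ℕ) :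
    qPochInf x q = qPoch x q n * qPochInf (x * q ^ n) q := by
  have h1 := (tendsto_qPoch x q hq1).comp (tendsto_add_atTop_nat n)
  have h2 := (tendsto_qPoch (x * q ^ n) q hq1).const_mul (qPoch x q n)
  refine tendsto_nhds_unique h1 (h2.congr fun m => ?_)
  rw [Function.comp, ← qPoch_add, add_comm]

/-- The finite products are polynomials in `x` and converge locally uniformly. -/
theorem differentiable_qPochInf {q : ℂ} (hq1 : ‖q‖ < 1) : Differentiable ℂ fun x => qPochInf x q := by
  have h : HasProdLocallyUniformlyOn (fun (j : ℕ) (x : ℂ) => 1 + -(x * q ^ j))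
      (fun x => ∏' j : ℕ, (1 + -(x * q ^ j))) Set.univ := by
    refine hasProdLocallyUniformlyOn_of_forall_compact isOpen_univ fun K _ hK => ?_
    obtain ⟨C, hC⟩ := hK.isBounded.exists_norm_le
    refine Summable.hasProdUniformlyOn_nat_one_add hK
      ((summable_geometric_of_lt_one (norm_nonneg q) hq1).mul_left C)
      (Eventually.of_forall fun n x hx => ?_) fun n => by fun_prop
    rw [norm_neg, norm_mul, norm_pow]
    have := hC x hx
    gcongr
  have h' := TendstoLocallyUniformlyOn.differentiableOn h (Eventually.of_forall fun s => by fun_prop)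
    isOpen_univ
  simp only [← sub_eq_add_neg] at h'
  exact differentiableOn_univ.1 h'

theorem exists_norm_qPoch_le {q : ℂ} (hq1 : ‖q‖ < 1) (x : ℂ) :
    ∃ C : ℝ, ∀ n, ‖qPoch x q n‖ ≤ C :=
  ⟨_, fun n => norm_qPoch_le hq1 le_rfl n⟩

/-- The inverses converge, because the limit `(x;q)_∞` is nonzero. -/
theorem exists_norm_inv_qPoch_le {q x : ℂ} (hq0 : q ≠ 0) (hq1 : ‖q‖ < 1) (hx : x ∉ OmegaQ q) :
    ∃ C : ℝ, ∀ n, ‖(qPoch x q n)⁻¹‖ ≤ C := by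
  obtain ⟨C, hC⟩ := ((tendsto_qPoch x q hq1).inv₀
    (qPochInf_ne_zero hq0 hq1 hx)).norm.bddAbove_range
  exact ⟨C, fun n => hC ⟨n, rfl⟩⟩

theorem exists_norm_mul_le {f g : ℕ → ℂ} (hf : ∃ C : ℝ, ∀ n, ‖f n‖ ≤ C)
    (hg : ∃ C : ℝ, ∀ n, ‖g n‖ ≤ C) : ∃ C : ℝ, ∀ n, ‖f n * g n‖ ≤ C := by
  obtain ⟨C, hC⟩ := hf
  obtain ⟨D, hD⟩ := hg
  refine ⟨C * D, fun n => ?_⟩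
  rw [norm_mul]
  exact mul_le_mul (hC n) (hD n) (norm_nonneg _) ((norm_nonneg _).trans (hC n))

theorem summable_pow_choose_two_mul_pow {ρ w : ℝ} (hρ0 : 0 < ρ) (hρ1 : ρ < 1) (hw : 0 ≤ w) :
    Summable fun k : ℕ => ρ ^ k.choose 2 * w ^ k := by
  rcases hw.eq_or_lt with rfl | hw
  -- The ratio test below divides by the terms, so `w = 0` is treated apart.
  · exact summable_of_ne_finset_zero (s := {0}) fun k hk => by
      simp [zero_pow (show k ≠ 0 by simpa using hk)]
  refine summable_of_ratio_test_tendsto_lt_one (l := 0) zero_lt_one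
    (Eventually.of_forall fun k => by positivity) ?_
  have h := (tendsto_pow_atTop_nhds_zero_of_lt_one hρ0.le hρ1).mul_const w
  rw [zero_mul] at h
  refine h.congr fun k => ?_
  rw [Real.norm_of_nonneg (by positivity), Real.norm_of_nonneg (by positivity),
    Nat.choose_succ_succ, Nat.choose_one_right, pow_add, pow_succ w]
  field_simp

/-! ### The polynomials that replace `(e;q)_k e⁻ᵏ`. -/

/-- The polynomial `∏_{j<k} (x - q^j)`, equal to `x^k (1/x;q)_k` for `x ≠ 0`. -/
noncomputable def shiftProd (q x : ℂ) (k : ℕ) : ℂ := ∏ j ∈ Finset.range k, (x - q ^ j)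

theorem shiftProd_inv {e : ℂ} (he : e ≠ 0) (q : ℂ) (k : ℕ) :
    shiftProd q e⁻¹ k = qPoch e q k * e⁻¹ ^ k := by
  have h : e⁻¹ ^ k = ∏ _j ∈ Finset.range k, e⁻¹ := by simp
  rw [shiftProd, qPoch, h, ← Finset.prod_mul_distrib]
  exact Finset.prod_congr rfl fun j _ => by field_simp

theorem shiftProd_zero (q : ℂ) (k : ℕ) : shiftProd q 0 k = (-1) ^ k * q ^ k.choose 2 := by
  induction k with
  | zero => simp [shiftProd]
  | succ k ih =>
    rw [shiftProd, Finset.prod_range_succ, ← shiftProd, ih, Nat.choose_succ_succ,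
      Nat.choose_one_right]
    ring

theorem shiftProd_pow_of_lt (q : ℂ) {N k : ℕ} (h : N < k) : shiftProd q (q ^ N) k = 0 :=
  Finset.prod_eq_zero (Finset.mem_range.2 h) (sub_self _)

theorem shiftProd_pow_mul (q : ℂ) (k l : ℕ) :
    shiftProd q (q ^ (k + l)) k * qPoch q q l = (-1) ^ k * q ^ k.choose 2 * qPoch q q (k + l) := by
  induction k generalizing l with
  | zero => simp [shiftProd]
  | succ k ih =>
    have h := ih (l + 1)
    rw [qPoch_succ, show k + (l + 1) = k + 1 + l by ring] at h
    rw [shiftProd, Finset.prod_range_succ, ← shiftProd, Nat.choose_succ_succ, Nat.choose_one_right]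
    rw [pow_add q k, pow_add q (k + 1), pow_succ (-1 : ℂ)]
    rw [pow_add q (k + 1)] at h
    linear_combination (-q ^ k) * h

/-- This brings the interpolation points `x = q^N` back to the Gaussian binomials of the terminating
sums. -/
theorem shiftProd_pow {q : ℂ} (hq1 : ‖q‖ < 1) {N k : ℕ} (h : k ≤ N) :
    shiftProd q (q ^ N) k = (-1) ^ k * q ^ k.choose 2 * qPoch q q k * qBinom q N k := by
  obtain ⟨l, rfl⟩ := Nat.exists_eq_add_of_le h
  apply mul_right_cancel₀ (qPoch_self_ne_zero hq1 l)
  rw [shiftProd_pow_mul, ← qBinom_mul_qPoch]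
  ring

/-- Each factor is at most `ρ + |q|^j = ρ (1 + ρ⁻¹ |q|^j)`, and the product of the brackets is
bounded uniformly in `k`. -/
theorem norm_shiftProd_le {q x : ℂ} (hq1 : ‖q‖ < 1) {ρ : ℝ} (hρ : 0 < ρ) (hx : ‖x‖ ≤ ρ) (k : ℕ) :
    ‖shiftProd q x k‖ ≤ Real.exp (ρ⁻¹ * (1 - ‖q‖)⁻¹) * ρ ^ k := by
  calc ‖shiftProd q x k‖ ≤ ∏ j ∈ Finset.range k, ((1 + ρ⁻¹ * ‖q‖ ^ j) * ρ) := by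
        rw [shiftProd, norm_prod]
        refine Finset.prod_le_prod (fun _ _ => norm_nonneg _) fun j _ => ?_
        refine (norm_sub_le _ _).trans ?_
        rw [norm_pow]
        field_simp
        linarith
    _ = (∏ j ∈ Finset.range k, (1 + ρ⁻¹ * ‖q‖ ^ j)) * ρ ^ k := by
        rw [Finset.prod_mul_distrib, Finset.prod_const, Finset.card_range]
    _ ≤ _ := by
        gcongr
        exact prod_one_add_mul_pow_le_exp (by positivity) (norm_nonneg q) hq1 k

theorem differentiableAt_tsum_of_norm_le {F : ℕ → ℂ → ℂ} (hF : ∀ k, Differentiable ℂ (F k)) {x : ℂ}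
    {ρ : ℝ} (hx : ‖x‖ < ρ) {u : ℕ → ℝ} (hu : Summable u)
    (h : ∀ k w, ‖w‖ ≤ ρ → ‖F k w‖ ≤ u k) : DifferentiableAt ℂ (fun w => ∑' k, F k w) x := by
  have hd := Complex.differentiableOn_tsum_of_summable_norm (U := Metric.ball 0 ρ) hu
    (fun k => (hF k).differentiableOn) Metric.isOpen_ball
    (fun k w hw => h k w (by simpa using (mem_ball_zero_iff.1 hw).le))
  exact hd.differentiableAt (Metric.isOpen_ball.mem_nhds (by simpa using hx))

theorem differentiable_shiftProd (q : ℂ) (k : ℕ) : Differentiable ℂ fun x => shiftProd q x k := by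
  unfold shiftProd; fun_prop

/-! ### Both sides as analytic functions of `x = 1/e`. -/

/-- The part of the `k`-th term of `₇W₆¹(a; b, c, d, e)` that does not depend on `e`. -/
noncomputable def vwpCoeff (q a b c d : ℂ) (k : ℕ) : ℂ :=
  (1 - a * q ^ (2 * k)) / (1 - a) * (qPoch a q k * qPoch b q k * qPoch c q k * qPoch d q k /
    (qPoch q q k * (qPoch (q * a / b) q k * qPoch (q * a / c) q k * qPoch (q * a / d) q k))) *
    ((-1) ^ k * q ^ k.choose 2) * (q ^ 2 * a ^ 2 / (b * c * d)) ^ k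

/-- The part of the `k`-th term of the `₃φ₂` that does not depend on `e`. -/
noncomputable def phiCoeff (q a b c d : ℂ) (k : ℕ) : ℂ :=
  qPoch (q * a / (b * c)) q k * qPoch d q k /
    (qPoch q q k * (qPoch (q * a / b) q k * qPoch (q * a / c) q k)) * (q * a / d) ^ k

/-- The very-well-poised series times `(qax;q)_∞`, as an entire function of `x = 1/e`. -/
noncomputable def vwpEntire (q a b c d x : ℂ) : ℂ :=
  ∑' k, vwpCoeff q a b c d k * shiftProd q x k * qPochInf (q * a * x * q ^ k) q

/-- The right-hand side times `(qax;q)_∞`, as a function of `x = 1/e`. -/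
noncomputable def phiProd (q a b c d x : ℂ) : ℂ :=
  qPochInf (q * a) q / qPochInf (q * a / d) q * qPochInf (q * a * x / d) q *
    ∑' k, phiCoeff q a b c d k * shiftProd q x k

theorem notMem_OmegaQ_of_norm_lt {q x : ℂ} (hq0 : q ≠ 0) (hq1 : ‖q‖ < 1) (hx : ‖x‖ < 1) :
    x ∉ OmegaQ q := by
  rw [notMem_OmegaQ_iff hq0]
  intro j h
  have h1 : ‖x‖ * ‖q‖ ^ j = 1 := by rw [← norm_pow, ← norm_mul, h, norm_one]
  have h2 := mul_le_of_le_one_right (norm_nonneg x) (pow_le_one₀ (n := j) (norm_nonneg q) hq1.le)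
  linarith

theorem q_notMem_OmegaQ {q : ℂ} (hq0 : q ≠ 0) (hq1 : ‖q‖ < 1) : q ∉ OmegaQ q :=
  notMem_OmegaQ_of_norm_lt hq0 hq1 hq1

theorem exists_norm_phiCoeff_le {q a b c d : ℂ} (hq0 : q ≠ 0) (hq1 : ‖q‖ < 1)
    (hB : q * a / b ∉ OmegaQ q) (hC : q * a / c ∉ OmegaQ q) :
    ∃ C : ℝ, ∀ k, ‖phiCoeff q a b c d k‖ ≤ C * ‖q * a / d‖ ^ k := by
  obtain ⟨C, h⟩ := exists_norm_mul_le (exists_norm_mul_le (exists_norm_qPoch_le hq1 (q * a / (b * c)))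
    (exists_norm_qPoch_le hq1 d)) (exists_norm_mul_le
      (exists_norm_inv_qPoch_le hq0 hq1 (q_notMem_OmegaQ hq0 hq1))
      (exists_norm_mul_le (exists_norm_inv_qPoch_le hq0 hq1 hB) (exists_norm_inv_qPoch_le hq0 hq1 hC)))
  refine ⟨C, fun k => ?_⟩
  rw [phiCoeff, norm_mul, norm_pow, div_eq_mul_inv, mul_inv, mul_inv]
  gcongr
  exact h k

theorem exists_norm_vwpCoeff_le {q a b c d : ℂ} (hq0 : q ≠ 0) (hq1 : ‖q‖ < 1)
    (hB : q * a / b ∉ OmegaQ q) (hC : q * a / c ∉ OmegaQ q) (hD : q * a / d ∉ OmegaQ q) :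
    ∃ C : ℝ, ∀ k, ‖vwpCoeff q a b c d k‖ ≤
      C * (‖q‖ ^ k.choose 2 * ‖q ^ 2 * a ^ 2 / (b * c * d)‖ ^ k) := by
  have h0 : ∃ C : ℝ, ∀ k : ℕ, ‖(1 - a * q ^ (2 * k)) / (1 - a)‖ ≤ C := by
    refine ⟨(1 + ‖a‖) / ‖1 - a‖, fun k => ?_⟩
    rw [norm_div]
    gcongr
    refine (norm_sub_le _ _).trans ?_
    rw [norm_one, norm_mul, norm_pow]
    gcongr
    exact mul_le_of_le_one_right (norm_nonneg a) (pow_le_one₀ (norm_nonneg q) hq1.le)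
  obtain ⟨C, h⟩ := exists_norm_mul_le h0 (exists_norm_mul_le
    (exists_norm_mul_le (exists_norm_mul_le (exists_norm_mul_le (exists_norm_qPoch_le hq1 a)
    (exists_norm_qPoch_le hq1 b)) (exists_norm_qPoch_le hq1 c)) (exists_norm_qPoch_le hq1 d))
    (exists_norm_mul_le (exists_norm_inv_qPoch_le hq0 hq1 (q_notMem_OmegaQ hq0 hq1))
      (exists_norm_mul_le (exists_norm_mul_le (exists_norm_inv_qPoch_le hq0 hq1 hB)
        (exists_norm_inv_qPoch_le hq0 hq1 hC)) (exists_norm_inv_qPoch_le hq0 hq1 hD))))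
  refine ⟨C, fun k => ?_⟩
  have := h k
  rw [vwpCoeff, norm_mul, norm_mul, norm_pow, norm_mul ((-1 : ℂ) ^ k), norm_pow, norm_pow, norm_neg,
    norm_one, one_pow, one_mul, mul_assoc ‖_‖, div_eq_mul_inv (_ * _) (qPoch q q k * _),
    mul_inv, mul_inv, mul_inv]
  gcongr

theorem summable_vwpCoeff_mul {q a b c d : ℂ} (hq0 : q ≠ 0) (hq1 : ‖q‖ < 1)
    (hB : q * a / b ∉ OmegaQ q) (hC : q * a / c ∉ OmegaQ q) (hD : q * a / d ∉ OmegaQ q) (x : ℂ) {g : ℕ → ℂ} (hg : ∃ C : ℝ, ∀ k, ‖g k‖ ≤ C) :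
    Summable fun k => vwpCoeff q a b c d k * shiftProd q x k * g k := by
  obtain ⟨C, h⟩ := exists_norm_vwpCoeff_le hq0 hq1 hB hC hD
  obtain ⟨D, hD'⟩ := hg
  have hD0 : 0 ≤ D := (norm_nonneg _).trans (hD' 0)
  have hρ : 0 < ‖x‖ + 1 := by positivity
  refine Summable.of_norm_bounded (((summable_pow_choose_two_mul_pow (norm_pos_iff.2 hq0) hq1
    (w := ‖q ^ 2 * a ^ 2 / (b * c * d)‖ * (‖x‖ + 1)) (by positivity)).mul_left
      (C * Real.exp ((‖x‖ + 1)⁻¹ * (1 - ‖q‖)⁻¹) * D))) fun k => ?_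
  rw [norm_mul, norm_mul]
  calc _ ≤ (C * (‖q‖ ^ k.choose 2 * ‖q ^ 2 * a ^ 2 / (b * c * d)‖ ^ k)) *
        (Real.exp ((‖x‖ + 1)⁻¹ * (1 - ‖q‖)⁻¹) * (‖x‖ + 1) ^ k) * D := by
        have h1 := h k
        have h2 := norm_shiftProd_le hq1 hρ (by linarith : ‖x‖ ≤ ‖x‖ + 1) k
        exact mul_le_mul (mul_le_mul h1 h2 (norm_nonneg _) ((norm_nonneg _).trans h1)) (hD' k)
          (norm_nonneg _) (mul_nonneg ((norm_nonneg _).trans h1) (by positivity))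
    _ = _ := by rw [mul_pow]; ring

theorem differentiable_vwpEntire {q a b c d : ℂ} (hq0 : q ≠ 0) (hq1 : ‖q‖ < 1)
    (hB : q * a / b ∉ OmegaQ q) (hC : q * a / c ∉ OmegaQ q) (hD : q * a / d ∉ OmegaQ q) : Differentiable ℂ (vwpEntire q a b c d) := by
  intro x
  obtain ⟨C, h⟩ := exists_norm_vwpCoeff_le hq0 hq1 hB hC hD
  have hρ : 0 < ‖x‖ + 1 := by positivity
  refine differentiableAt_tsum_of_norm_le (ρ := ‖x‖ + 1) (fun k => ?_) (by linarith)
    (((summable_pow_choose_two_mul_pow (norm_pos_iff.2 hq0) hq1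
    (w := ‖q ^ 2 * a ^ 2 / (b * c * d)‖ * (‖x‖ + 1)) (by positivity)).mul_left
      (C * Real.exp ((‖x‖ + 1)⁻¹ * (1 - ‖q‖)⁻¹) *
        Real.exp (‖q * a‖ * (‖x‖ + 1) * (1 - ‖q‖)⁻¹)))) fun k w hw => ?_
  · have h1 := (differentiable_qPochInf hq1).comp
      (by fun_prop : Differentiable ℂ fun x => q * a * x * q ^ k)
    exact ((differentiable_const _).mul (differentiable_shiftProd q k)).mul h1
  rw [norm_mul, norm_mul]
  have h1 := h k
  have h2 := norm_shiftProd_le hq1 hρ hw k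
  have h3 : ‖qPochInf (q * a * w * q ^ k) q‖ ≤ Real.exp (‖q * a‖ * (‖x‖ + 1) * (1 - ‖q‖)⁻¹) := by
    refine norm_qPochInf_le hq1 ?_
    rw [norm_mul, norm_mul (q * a), norm_pow]
    calc _ ≤ ‖q * a‖ * ‖w‖ * 1 := by
          gcongr
          exact pow_le_one₀ (norm_nonneg q) hq1.le
      _ ≤ _ := by rw [mul_one]; gcongr
  calc _ ≤ (C * (‖q‖ ^ k.choose 2 * ‖q ^ 2 * a ^ 2 / (b * c * d)‖ ^ k)) *
        (Real.exp ((‖x‖ + 1)⁻¹ * (1 - ‖q‖)⁻¹) * (‖x‖ + 1) ^ k) *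
          Real.exp (‖q * a‖ * (‖x‖ + 1) * (1 - ‖q‖)⁻¹) :=
        mul_le_mul (mul_le_mul h1 h2 (norm_nonneg _) ((norm_nonneg _).trans h1)) h3
          (norm_nonneg _) (mul_nonneg ((norm_nonneg _).trans h1) (by positivity))
    _ = _ := by rw [mul_pow]; ring

theorem summable_phiCoeff_mul_bound {q a b c d : ℂ} (hq0 : q ≠ 0) (hq1 : ‖q‖ < 1)
    (hB : q * a / b ∉ OmegaQ q) (hC : q * a / c ∉ OmegaQ q) {ρ : ℝ} (hρ : 0 < ρ) (h : ‖q * a / d‖ * ρ < 1) :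
    ∃ u : ℕ → ℝ, Summable u ∧ ∀ k w, ‖w‖ ≤ ρ → ‖phiCoeff q a b c d k * shiftProd q w k‖ ≤ u k := by
  obtain ⟨C, hC'⟩ := exists_norm_phiCoeff_le (d := d) hq0 hq1 hB hC
  refine ⟨_, (summable_geometric_of_lt_one (by positivity) h).mul_left
    (C * Real.exp (ρ⁻¹ * (1 - ‖q‖)⁻¹)), fun k w hw => ?_⟩
  rw [norm_mul]
  have h1 := hC' k
  have h2 := norm_shiftProd_le hq1 hρ hw k
  calc _ ≤ (C * ‖q * a / d‖ ^ k) * (Real.exp (ρ⁻¹ * (1 - ‖q‖)⁻¹) * ρ ^ k) :=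
        mul_le_mul h1 h2 (norm_nonneg _) ((norm_nonneg _).trans h1)
    _ = _ := by rw [mul_pow]; ring

theorem exists_between_norm {z x : ℂ} (h : ‖z * x‖ < 1) : ∃ ρ, ‖x‖ < ρ ∧ ‖z‖ * ρ < 1 := by
  have hc : Tendsto (fun ρ : ℝ => ‖z‖ * ρ) (𝓝[>] ‖x‖) (𝓝 (‖z‖ * ‖x‖)) :=
    ((continuous_const.mul continuous_id).tendsto _).mono_left nhdsWithin_le_nhds
  rw [← norm_mul] at hc
  exact (Eventually.and (eventually_mem_nhdsWithin) (hc.eventually_lt_const h)).exists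

theorem summable_phiCoeff_mul {q a b c d : ℂ} (hq0 : q ≠ 0) (hq1 : ‖q‖ < 1)
    (hB : q * a / b ∉ OmegaQ q) (hC : q * a / c ∉ OmegaQ q) {x : ℂ} (h : ‖q * a / d * x‖ < 1) :
    Summable fun k => phiCoeff q a b c d k * shiftProd q x k := by
  obtain ⟨ρ, h1, h2⟩ := exists_between_norm h
  obtain ⟨u, hu, hb⟩ := summable_phiCoeff_mul_bound (d := d) hq0 hq1 hB hC
    ((norm_nonneg x).trans_lt h1) h2
  exact Summable.of_norm_bounded hu fun k => hb k x h1.le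

theorem differentiableAt_phiProd {q a b c d : ℂ} (hq1 : ‖q‖ < 1) {x : ℂ}
    (h : DifferentiableAt ℂ (fun x => ∑' k, phiCoeff q a b c d k * shiftProd q x k) x) :
    DifferentiableAt ℂ (phiProd q a b c d) x := by
  have h1 := (differentiable_qPochInf hq1).comp
      (by fun_prop : Differentiable ℂ fun x => q * a * x / d)
  exact ((differentiableAt_const _).mul h1.differentiableAt).mul h

theorem differentiableAt_phiProd_of_norm_lt {q a b c d : ℂ} (hq0 : q ≠ 0) (hq1 : ‖q‖ < 1)
    (hB : q * a / b ∉ OmegaQ q) (hC : q * a / c ∉ OmegaQ q) {x : ℂ} (h : ‖q * a / d * x‖ < 1) :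
    DifferentiableAt ℂ (phiProd q a b c d) x := by
  obtain ⟨ρ, h1, h2⟩ := exists_between_norm h
  obtain ⟨u, hu, hb⟩ := summable_phiCoeff_mul_bound (d := d) hq0 hq1 hB hC
    ((norm_nonneg x).trans_lt h1) h2
  exact differentiableAt_phiProd hq1 (differentiableAt_tsum_of_norm_le
    (fun k => (differentiable_const _).mul (differentiable_shiftProd q k)) h1 hu hb)

theorem differentiable_phiProd_of_terminating {q a b c d : ℂ} (hq1 : ‖q‖ < 1) {n : ℕ}
    (h : ∀ k, n ≤ k → phiCoeff q a b c d k = 0) : Differentiable ℂ (phiProd q a b c d) := by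
  intro x
  refine differentiableAt_phiProd hq1 ?_
  have : (fun x => ∑' k, phiCoeff q a b c d k * shiftProd q x k) =
      fun x => ∑ k ∈ Finset.range n, phiCoeff q a b c d k * shiftProd q x k := by
    funext x
    exact tsum_eq_sum fun k hk => by rw [h k (by simpa using hk), zero_mul]
  rw [this]
  exact DifferentiableAt.fun_sum fun k _ =>
    ((differentiable_const _).mul (differentiable_shiftProd q k)).differentiableAt

/-- At `x = q^N` the factor `shiftProd` kills all terms with `k > N`; splitting off the first
factors of the infinite products leaves exactly the terminating Watson transformation. -/
theorem vwpEntire_pow_eq_phiProd {q a b c d : ℂ} (hq0 : q ≠ 0) (hq1 : ‖q‖ < 1)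
    (hB : q * a / b ∉ OmegaQ q) (hC : q * a / c ∉ OmegaQ q) (hD : q * a / d ∉ OmegaQ q) (ha1 : a ≠ 1) (hb : b ≠ 0) (hc : c ≠ 0) (hd : d ≠ 0) (N : ℕ)
    (hN : q * a * q ^ N ∉ OmegaQ q) :
    vwpEntire q a b c d (q ^ N) = phiProd q a b c d (q ^ N) := by
  have hW := watson_terminating hq0 hq1 hb hc hd hB hC hD N hN
  have n1 : 1 - a ≠ 0 := sub_ne_zero.2 ha1.symm
  have nD : qPoch (q * a / d) q N ≠ 0 :=
    qPoch_ne_zero _ fun j _ => (notMem_OmegaQ_iff hq0).1 hD j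
  have nD' : qPochInf (q * a / d * q ^ N) q ≠ 0 := by
    have := qPochInf_ne_zero hq0 hq1 hD
    rw [qPochInf_eq_mul hq1 _ N] at this
    exact right_ne_zero_of_mul this
  have e1 : vwpEntire q a b c d (q ^ N) = qPochInf (q * a * q ^ N) q * ((1 - a)⁻¹ *
      ∑ r ∈ Finset.range (N + 1), qBinom q N r * ((q ^ r.choose 2) ^ 2 * (1 - a * q ^ (2 * r)) *
      (qPoch a q r * qPoch b q r * qPoch c q r * qPoch d q r / (qPoch (q * a / b) q r *
        qPoch (q * a / c) q r * qPoch (q * a / d) q r * qPoch (q * a * q ^ N) q r)) *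
      (q ^ 2 * a ^ 2 / (b * c * d)) ^ r)) := by
    rw [vwpEntire, tsum_eq_sum (s := Finset.range (N + 1)) fun k hk => by
      rw [shiftProd_pow_of_lt q (by simpa using hk), mul_zero, zero_mul],
      Finset.mul_sum, Finset.mul_sum]
    refine Finset.sum_congr rfl fun k hk => ?_
    have nN : qPoch (q * a * q ^ N) q k ≠ 0 :=
      qPoch_ne_zero _ fun j _ => (notMem_OmegaQ_iff hq0).1 hN j
    have nq := qPoch_self_ne_zero hq1 k
    have s1 : ((-1 : ℂ) ^ k) * (-1) ^ k = 1 := by rw [← mul_pow]; simp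
    rw [shiftProd_pow hq1 (Nat.lt_succ_iff.1 (Finset.mem_range.1 hk)),
      qPochInf_eq_mul hq1 (q * a * q ^ N) k, vwpCoeff]
    generalize qPochInf (q * a * q ^ N * q ^ k) q = V
    generalize qPoch (q * a * q ^ N) q k = V' at *
    generalize qPoch (q * a / b) q k = X
    generalize qPoch (q * a / c) q k = Y
    generalize qPoch (q * a / d) q k = Z
    generalize (q ^ 2 * a ^ 2 / (b * c * d)) ^ k = U
    generalize qPoch q q k = Q at *
    generalize (-1 : ℂ) ^ k = s at *
    have i1 : Q⁻¹ * Q = 1 := inv_mul_cancel₀ nq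
    have i2 : V' * V'⁻¹ = 1 := mul_inv_cancel₀ nN
    -- `(q;q)_k` and the sign cancel; `V' * V'⁻¹` is then inserted to match the denominator `(q a
    -- q^N;q)_k` of the finite sum.
    calc _ = (Q⁻¹ * Q) * (s * s) * (qBinom q N k * (q ^ k.choose 2) ^ 2 * (1 - a * q ^ (2 * k)) *
          (1 - a)⁻¹ * (qPoch a q k * qPoch b q k * qPoch c q k * qPoch d q k / (X * Y * Z)) *
          U * V) := by ring
      _ = (V' * V'⁻¹) * (qBinom q N k * (q ^ k.choose 2) ^ 2 * (1 - a * q ^ (2 * k)) *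
          (1 - a)⁻¹ * (qPoch a q k * qPoch b q k * qPoch c q k * qPoch d q k / (X * Y * Z)) *
          U * V) := by rw [i1, s1, i2]; ring
      _ = _ := by ring
  have e2 : ∑' k, phiCoeff q a b c d k * shiftProd q (q ^ N) k = ∑ n ∈ Finset.range (N + 1),
      qBinom q N n * ((-1) ^ n * q ^ n.choose 2 * (qPoch (q * a / (b * c)) q n * qPoch d q n /
        (qPoch (q * a / b) q n * qPoch (q * a / c) q n)) * (q * a / d) ^ n) := by
    rw [tsum_eq_sum (s := Finset.range (N + 1)) fun k hk => by
      rw [shiftProd_pow_of_lt q (by simpa using hk), mul_zero]]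
    refine Finset.sum_congr rfl fun k hk => ?_
    have nq := qPoch_self_ne_zero hq1 k
    rw [shiftProd_pow hq1 (Nat.lt_succ_iff.1 (Finset.mem_range.1 hk)), phiCoeff]
    generalize qPoch q q k = Q at *
    generalize qPoch (q * a / b) q k = X
    generalize qPoch (q * a / c) q k = Y
    generalize q * a / d = U
    have i1 : Q⁻¹ * Q = 1 := inv_mul_cancel₀ nq
    calc _ = (Q⁻¹ * Q) * (qBinom q N k * ((-1) ^ k * q ^ k.choose 2 *
          (qPoch (q * a / (b * c)) q k * qPoch d q k / (X * Y)) * U ^ k)) := by ring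
      _ = _ := by rw [i1, one_mul]
  rw [e1, ← hW, phiProd, e2, qPochInf_eq_mul hq1 (q * a) N, qPochInf_eq_mul hq1 (q * a / d) N,
    show q * a * q ^ N / d = q * a / d * q ^ N by ring]
  generalize qPochInf (q * a / d * q ^ N) q = Z' at *
  generalize qPoch (q * a / d) q N = Z at *
  field_simp

/-! ### Rewriting the hypergeometric terms. -/

theorem exists_qPoch_eq_zero {q x : ℂ} (hq0 : q ≠ 0) (hx : x ∈ OmegaQ q) :
    ∃ n, ∀ k, n ≤ k → qPoch x q k = 0 := by
  obtain ⟨j, hj⟩ := (mem_OmegaQ_iff hq0).1 hx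
  exact ⟨j + 1, fun k hk => Finset.prod_eq_zero (Finset.mem_range.2 hk) (by rw [hj, sub_self])⟩

theorem summable_of_exists_eq_zero {f : ℕ → ℂ} (h : ∃ n, ∀ k, n ≤ k → f k = 0) : Summable f := by
  obtain ⟨n, hn⟩ := h
  exact summable_of_ne_finset_zero (s := Finset.range n) fun k hk => hn k (by simpa using hk)

/-- The very-well-poised factor of a summand. -/
theorem qPoch_sqrt_ratio {a q s : ℂ} (hs : s ^ 2 = a) (k : ℕ) (h1 : qPoch s q k ≠ 0)
    (h2 : qPoch (-s) q k ≠ 0) (ha : a ≠ 1) :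
    qPoch (q * s) q k * qPoch (-(q * s)) q k / (qPoch s q k * qPoch (-s) q k) =
      (1 - a * q ^ (2 * k)) / (1 - a) := by
  have e1 : (1 - s) * qPoch (q * s) q k = qPoch s q k * (1 - s * q ^ k) := by
    rw [mul_comm q, ← qPoch_succ', qPoch_succ]
  have e2 : (1 + s) * qPoch (-(q * s)) q k = qPoch (-s) q k * (1 + s * q ^ k) := by
    have := qPoch_succ' (-s) q k
    rw [qPoch_succ] at this
    rw [show -(q * s) = -s * q by ring]
    linear_combination -this
  have n1 : 1 - a ≠ 0 := sub_ne_zero.2 ha.symm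
  rw [div_eq_div_iff (mul_ne_zero h1 h2) n1, ← hs]
  linear_combination ((1 + s) * qPoch (-(q * s)) q k) * e1 + (qPoch s q k * (1 - s * q ^ k)) * e2

theorem complex_sqrt_sq (a : ℂ) : a.sqrt ^ 2 = a := by
  rw [Complex.sqrt, ← Complex.cpow_nat_mul]; simp

theorem ne_one_of_sqrt_notMem {q a : ℂ} (hq0 : q ≠ 0) (hs : a.sqrt ∉ OmegaQ q) : a ≠ 1 := by
  rintro rfl
  exact (notMem_OmegaQ_iff hq0).1 hs 0 (by simp)

theorem vwpTerm_one_eq {q a b c d : ℂ} (hq0 : q ≠ 0) (hs : a.sqrt ∉ OmegaQ q)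
    (hs' : -a.sqrt ∉ OmegaQ q) {e : ℂ} (he : e ≠ 0) (k : ℕ) :
    vwpTerm 1 a [b, c, d, e] q (q ^ 2 * a ^ 2 / (b * c * d * e)) k =
      vwpCoeff q a b c d k * shiftProd q e⁻¹ k * (qPoch (q * a / e) q k)⁻¹ := by
  have hr := qPoch_sqrt_ratio (q := q) (complex_sqrt_sq a) k
    (qPoch_ne_zero _ fun j _ => (notMem_OmegaQ_iff hq0).1 hs j)
    (qPoch_ne_zero _ fun j _ => (notMem_OmegaQ_iff hq0).1 hs' j) (ne_one_of_sqrt_notMem hq0 hs)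
  have h0 : qPoch 0 q k = 1 := by simp [qPoch]
  have hz : q ^ 2 * a ^ 2 / (b * c * d * e) = q ^ 2 * a ^ 2 / (b * c * d) * e⁻¹ := by
    rw [← div_div, div_eq_mul_inv _ e]
  rw [vwpCoeff, ← hr, shiftProd_inv he, vwpTerm, phiTerm, hz, mul_pow]
  simp [zeroNum, zeroDen, vwpNum, vwpDen, qPochList, h0]
  ring

/-- Here the exponent `1 + s - r` is `2`: one factor `(-1)^k q^(k choose 2)` belongs to `vwpCoeff`,
and the other is `shiftProd` at `0`. -/
theorem vwpTerm_two_eq {q a b c d : ℂ} (hq0 : q ≠ 0) (hs : a.sqrt ∉ OmegaQ q)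
    (hs' : -a.sqrt ∉ OmegaQ q) (k : ℕ) :
    vwpTerm 2 a [b, c, d] q (q ^ 2 * a ^ 2 / (b * c * d)) k =
      vwpCoeff q a b c d k * shiftProd q 0 k := by
  have hr := qPoch_sqrt_ratio (q := q) (complex_sqrt_sq a) k
    (qPoch_ne_zero _ fun j _ => (notMem_OmegaQ_iff hq0).1 hs j)
    (qPoch_ne_zero _ fun j _ => (notMem_OmegaQ_iff hq0).1 hs' j) (ne_one_of_sqrt_notMem hq0 hs)
  have h0 : qPoch 0 q k = 1 := by simp [qPoch]
  rw [vwpCoeff, ← hr, shiftProd_zero, vwpTerm, phiTerm]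
  simp [zeroNum, zeroDen, vwpNum, vwpDen, qPochList, h0]
  norm_cast
  ring

theorem phiTerm_three_two_eq {q a b c d : ℂ} {e : ℂ} (he : e ≠ 0) (k : ℕ) :
    phiTerm [q * a / (b * c), d, e] [q * a / b, q * a / c] q (q * a / (d * e)) k =
      phiCoeff q a b c d k * shiftProd q e⁻¹ k := by
  have hz : q * a / (d * e) = q * a / d * e⁻¹ := by rw [← div_div, div_eq_mul_inv _ e]
  rw [phiCoeff, shiftProd_inv he, phiTerm, hz, mul_pow]
  simp [qPochList]
  ring

theorem phiTerm_two_two_eq {q a b c d : ℂ} (k : ℕ) :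
    phiTerm [q * a / (b * c), d] [q * a / b, q * a / c] q (q * a / d) k =
      phiCoeff q a b c d k * shiftProd q 0 k := by
  rw [phiCoeff, shiftProd_zero, phiTerm]
  simp [qPochList]
  ring

/-! ### The identity theorem and formula (i). -/

/-- The two functions agree at `q^N` for all large `N`, where `|q a q^N| < 1` excludes vanishing
denominators. These points are nonzero and tend to `0 ∈ U`. -/
theorem eqOn_vwpEntire_phiProd {q a b c d : ℂ} (hq0 : q ≠ 0) (hq1 : ‖q‖ < 1)
    (hB : q * a / b ∉ OmegaQ q) (hC : q * a / c ∉ OmegaQ q) (hD : q * a / d ∉ OmegaQ q)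
    (hb : b ≠ 0) (hc : c ≠ 0) (hd : d ≠ 0) (ha1 : a ≠ 1) {U : Set ℂ} (hU : IsOpen U) (hU' : IsPreconnected U)
    (h0 : 0 ∈ U) (hdiff : DifferentiableOn ℂ (phiProd q a b c d) U) :
    Set.EqOn (vwpEntire q a b c d) (phiProd q a b c d) U := by
  have hV : DifferentiableOn ℂ (vwpEntire q a b c d) U :=
    (differentiable_vwpEntire hq0 hq1 hB hC hD).differentiableOn
  have hlim : Tendsto (fun N : ℕ => q ^ N) atTop (𝓝 0) :=
    tendsto_pow_atTop_nhds_zero_of_norm_lt_one hq1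
  have hlim' : Tendsto (fun N : ℕ => q ^ N) atTop (𝓝[≠] 0) :=
    tendsto_nhdsWithin_iff.2 ⟨hlim, Eventually.of_forall fun N => pow_ne_zero N hq0⟩
  have hsmall : ∀ᶠ N : ℕ in atTop, ‖q * a * q ^ N‖ < 1 := by
    have := (hlim.const_mul (q * a)).norm
    rw [mul_zero, norm_zero] at this
    exact this.eventually_lt_const zero_lt_one
  refine (hV.analyticOnNhd hU).eqOn_of_preconnected_of_frequently_eq (hdiff.analyticOnNhd hU) hU' h0
    (hlim'.frequently (Eventually.frequently ?_))
  filter_upwards [hsmall] with N hN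
  exact vwpEntire_pow_eq_phiProd hq0 hq1 hB hC hD ha1 hb hc hd N
    (notMem_OmegaQ_of_norm_lt hq0 hq1 hN)

theorem vwpEntire_eq_phiProd_of_norm_lt {q a b c d : ℂ} (hq0 : q ≠ 0) (hq1 : ‖q‖ < 1)
    (hB : q * a / b ∉ OmegaQ q) (hC : q * a / c ∉ OmegaQ q) (hD : q * a / d ∉ OmegaQ q)
    (hb : b ≠ 0) (hc : c ≠ 0) (hd : d ≠ 0) (ha1 : a ≠ 1) {x : ℂ} (hx : ‖q * a / d * x‖ < 1) :
    vwpEntire q a b c d x = phiProd q a b c d x := by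
  -- Viewing the domain as a linear preimage of the unit ball also covers `qa/d = 0`, when it is the
  -- whole plane.
  have hconv : Convex ℝ {x : ℂ | ‖q * a / d * x‖ < 1} := by
    have h := (convex_ball (0 : ℂ) 1).linear_preimage (LinearMap.mulLeft ℝ (q * a / d))
    have hset : {x : ℂ | ‖q * a / d * x‖ < 1} =
        LinearMap.mulLeft ℝ (q * a / d) ⁻¹' Metric.ball 0 1 := by
      ext x; simp
    rw [hset]; exact h
  refine eqOn_vwpEntire_phiProd hq0 hq1 hB hC hD hb hc hd ha1
    (U := {x | ‖q * a / d * x‖ < 1}) (isOpen_lt (by fun_prop) (by fun_prop))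
    hconv.isPreconnected (by simp) (fun y hy => ?_) hx
  exact (differentiableAt_phiProd_of_norm_lt hq0 hq1 hB hC hy).differentiableWithinAt

theorem vwpEntire_eq_phiProd_of_terminating {q a b c d : ℂ} (hq0 : q ≠ 0) (hq1 : ‖q‖ < 1)
    (hB : q * a / b ∉ OmegaQ q) (hC : q * a / c ∉ OmegaQ q) (hD : q * a / d ∉ OmegaQ q)
    (hb : b ≠ 0) (hc : c ≠ 0) (hd : d ≠ 0) (ha1 : a ≠ 1)
    (h : ∃ n, ∀ k, n ≤ k → phiCoeff q a b c d k = 0) (x : ℂ) :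
    vwpEntire q a b c d x = phiProd q a b c d x := by
  obtain ⟨n, hn⟩ := h
  exact eqOn_vwpEntire_phiProd hq0 hq1 hB hC hD hb hc hd ha1 isOpen_univ isPreconnected_univ
    (Set.mem_univ _) (differentiable_phiProd_of_terminating hq1 hn).differentiableOn (Set.mem_univ x)

theorem phiCoeff_terminating {q a b c d : ℂ} (hq0 : q ≠ 0) (h : q * a / (b * c) ∈ OmegaQ q ∨ d ∈ OmegaQ q) :
    ∃ n, ∀ k, n ≤ k → phiCoeff q a b c d k = 0 := by
  rcases h with h | h <;> obtain ⟨n, hn⟩ := exists_qPoch_eq_zero hq0 h <;>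
    exact ⟨n, fun k hk => by rw [phiCoeff, hn k hk]; simp⟩

theorem vwpEntire_inv_eq_phiProd {q a b c d : ℂ} (hq0 : q ≠ 0) (hq1 : ‖q‖ < 1)
    (hB : q * a / b ∉ OmegaQ q) (hC : q * a / c ∉ OmegaQ q) (hD : q * a / d ∉ OmegaQ q)
    (hb : b ≠ 0) (hc : c ≠ 0) (hd : d ≠ 0) (ha1 : a ≠ 1) {e : ℂ} (hE : q * a / e ∉ OmegaQ q)
    (h : ‖q * a / (d * e)‖ < 1 ∨ q * a / (b * c) ∈ OmegaQ q ∨ d ∈ OmegaQ q ∨ e ∈ OmegaQ q) :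
    vwpEntire q a b c d e⁻¹ = phiProd q a b c d e⁻¹ := by
  rcases h with h | h | h | h
  · refine vwpEntire_eq_phiProd_of_norm_lt hq0 hq1 hB hC hD hb hc hd ha1 ?_
    rwa [← div_eq_mul_inv, div_div]
  · exact vwpEntire_eq_phiProd_of_terminating hq0 hq1 hB hC hD hb hc hd ha1
      (phiCoeff_terminating hq0 (Or.inl h)) _
  · exact vwpEntire_eq_phiProd_of_terminating hq0 hq1 hB hC hD hb hc hd ha1
      (phiCoeff_terminating hq0 (Or.inr h)) _
  -- Here `1/e = q^N` may lie outside the disc of analyticity of `phiProd`, but it is an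
  -- interpolation point.
  · obtain ⟨N, rfl⟩ := h
    rw [inv_inv]
    refine vwpEntire_pow_eq_phiProd hq0 hq1 hB hC hD ha1 hb hc hd N ?_
    rwa [div_inv_eq_mul] at hE

theorem summable_phiTerm_three_two {q a b c d : ℂ} (hq0 : q ≠ 0) (hq1 : ‖q‖ < 1)
    (hB : q * a / b ∉ OmegaQ q) (hC : q * a / c ∉ OmegaQ q) {e : ℂ} (he : e ≠ 0)
    (h : ‖q * a / (d * e)‖ < 1 ∨ q * a / (b * c) ∈ OmegaQ q ∨ d ∈ OmegaQ q ∨ e ∈ OmegaQ q) :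
    Summable (phiTerm [q * a / (b * c), d, e] [q * a / b, q * a / c] q (q * a / (d * e))) := by
  rw [funext (phiTerm_three_two_eq he)]
  have key (h : q * a / (b * c) ∈ OmegaQ q ∨ d ∈ OmegaQ q) :
      Summable fun k => phiCoeff q a b c d k * shiftProd q e⁻¹ k := by
    obtain ⟨n, hn⟩ := phiCoeff_terminating hq0 h
    exact summable_of_exists_eq_zero ⟨n, fun k hk => by rw [hn k hk, zero_mul]⟩
  rcases h with h | h | h | h
  · exact summable_phiCoeff_mul hq0 hq1 hB hC (by rwa [← div_eq_mul_inv, div_div])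
  · exact key (Or.inl h)
  · exact key (Or.inr h)
  · obtain ⟨N, rfl⟩ := h
    rw [inv_inv]
    exact summable_of_exists_eq_zero ⟨N + 1, fun k hk => by
      rw [shiftProd_pow_of_lt q hk, mul_zero]⟩

/-- Termwise, `(qa/e;q)_∞ / (qa/e;q)_k = (q^(k+1) a/e;q)_∞`, which removes the poles in `1/e`. -/
theorem vwp_one_mul_qPochInf {q a b c d : ℂ} (hq0 : q ≠ 0) (hq1 : ‖q‖ < 1)
    (hs : a.sqrt ∉ OmegaQ q) (hs' : -a.sqrt ∉ OmegaQ q) {e : ℂ} (he : e ≠ 0) (hE : q * a / e ∉ OmegaQ q) :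
    qPochInf (q * a / e) q * vwp 1 a [b, c, d, e] q (q ^ 2 * a ^ 2 / (b * c * d * e)) =
      vwpEntire q a b c d e⁻¹ := by
  rw [vwp, vwpEntire, ← tsum_mul_left]
  refine tsum_congr fun k => ?_
  have h1 : qPoch (q * a / e) q k ≠ 0 :=
    qPoch_ne_zero _ fun j _ => (notMem_OmegaQ_iff hq0).1 hE j
  rw [vwpTerm_one_eq hq0 hs hs' he, qPochInf_eq_mul hq1 _ k, ← div_eq_mul_inv (q * a) e]
  field_simp

/-- The nonterminating limiting case of Watson's transformation. -/
theorem vwp_one_eq {q a b c d : ℂ} (hq0 : q ≠ 0) (hq1 : ‖q‖ < 1) (hB : q * a / b ∉ OmegaQ q)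
    (hC : q * a / c ∉ OmegaQ q) (hD : q * a / d ∉ OmegaQ q) (hb : b ≠ 0) (hc : c ≠ 0) (hd : d ≠ 0)
    (hs : a.sqrt ∉ OmegaQ q) (hs' : -a.sqrt ∉ OmegaQ q) {e : ℂ} (he : e ≠ 0) (hE : q * a / e ∉ OmegaQ q)
    (h : ‖q * a / (d * e)‖ < 1 ∨ q * a / (b * c) ∈ OmegaQ q ∨ d ∈ OmegaQ q ∨ e ∈ OmegaQ q) :
    vwp 1 a [b, c, d, e] q (q ^ 2 * a ^ 2 / (b * c * d * e)) =
        qPochInfList [q * a, q * a / (d * e)] q / qPochInfList [q * a / d, q * a / e] q *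
          phi [q * a / (b * c), d, e] [q * a / b, q * a / c] q (q * a / (d * e)) := by
  have h1 := vwp_one_mul_qPochInf (b := b) (c := c) (d := d) hq0 hq1 hs hs' he hE
  rw [vwpEntire_inv_eq_phiProd hq0 hq1 hB hC hD hb hc hd (ne_one_of_sqrt_notMem hq0 hs) hE h,
    phiProd] at h1
  have nE := qPochInf_ne_zero hq0 hq1 hE
  have nD := qPochInf_ne_zero hq0 hq1 hD
  rw [phi, funext (phiTerm_three_two_eq he)]
  apply mul_left_cancel₀ nE
  rw [h1, show q * a * e⁻¹ / d = q * a / (d * e) by rw [← div_div, div_right_comm]; rfl]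
  simp only [qPochInfList, List.map_cons, List.map_nil, List.prod_cons, List.prod_nil, mul_one]
  generalize qPochInf (q * a / e) q = X at *
  generalize qPochInf (q * a / d) q = Y at *
  field_simp

/-! ### The `₂φ₁` form and the conclusion. -/

theorem summable_phiTerm_two_one {q a b c d : ℂ} (hq0 : q ≠ 0) (hq1 : ‖q‖ < 1)
    (hC : q * a / c ∉ OmegaQ q) (h : ‖q * a / (b * d)‖ < 1 ∨ b ∈ OmegaQ q ∨ d ∈ OmegaQ q) :
    Summable (phiTerm [b, d] [q * a / c] q (q * a / (b * d))) := by
  have e (k : ℕ) : phiTerm [b, d] [q * a / c] q (q * a / (b * d)) k =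
      qPoch b q k * qPoch d q k * ((qPoch q q k)⁻¹ * (qPoch (q * a / c) q k)⁻¹) *
        (q * a / (b * d)) ^ k := by
    rw [phiTerm]; simp [qPochList, -mul_eq_mul_right_iff]; ring
  rw [funext e]
  rcases h with h | h | h
  · obtain ⟨C, hC'⟩ := exists_norm_mul_le (exists_norm_mul_le (exists_norm_qPoch_le hq1 b)
      (exists_norm_qPoch_le hq1 d)) (exists_norm_mul_le
      (exists_norm_inv_qPoch_le hq0 hq1 (q_notMem_OmegaQ hq0 hq1))
      (exists_norm_inv_qPoch_le hq0 hq1 hC))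
    refine Summable.of_norm_bounded ((summable_geometric_of_lt_one (norm_nonneg _) h).mul_left C)
      fun k => ?_
    rw [norm_mul, norm_pow]
    have := hC' k
    gcongr
  all_goals
    obtain ⟨n, hn⟩ := exists_qPoch_eq_zero hq0 h
    exact summable_of_exists_eq_zero ⟨n, fun k hk => by rw [hn k hk]; simp⟩

/-- For small `x ≠ 0`, (i) with permuted parameters gives a `₃φ₂` whose argument `qa/(bd)` does not
depend on `x`; as `x → 0` it tends to the `₂φ₁`. -/
theorem vwpEntire_zero_eq {q a b c d : ℂ} (hq0 : q ≠ 0) (hq1 : ‖q‖ < 1)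
    (hB : q * a / b ∉ OmegaQ q) (hC : q * a / c ∉ OmegaQ q) (hD : q * a / d ∉ OmegaQ q)
    (hb : b ≠ 0) (hc : c ≠ 0) (hd : d ≠ 0) (hs : a.sqrt ∉ OmegaQ q) (hs' : -a.sqrt ∉ OmegaQ q) (h : ‖q * a / (b * d)‖ < 1 ∨ b ∈ OmegaQ q ∨ d ∈ OmegaQ q) :
    vwpEntire q a b c d 0 =
      qPochInfList [q * a, q * a / (b * d)] q / qPochInfList [q * a / b, q * a / d] q *
          phi [b, d] [q * a / c] q (q * a / (b * d)) := by
  have hsum := summable_phiTerm_two_one hq0 hq1 hC h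
  set K := qPochInfList [q * a, q * a / (b * d)] q / qPochInfList [q * a / b, q * a / d] q
  set g := phiTerm [b, d] [q * a / c] q (q * a / (b * d)) with hg
  -- This is the permuted right-hand side times `(qax;q)_∞`, with the denominator `(qax;q)_k`
  -- absorbed. On `|x| ≤ 1` the factors depending on `x` are bounded uniformly in `k`, so the `₂φ₁`
  -- terms supply a summable majorant.
  have hcont : ContinuousAt (fun x => K * ∑' k, g k * (qPoch (q * a * x / c) q k *
      qPochInf (q * a * x * q ^ k) q)) 0 := by
    refine continuousAt_const.mul (DifferentiableAt.continuousAt (𝕜 := ℂ)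
      (differentiableAt_tsum_of_norm_le (ρ := 1) (fun k => ?_) (by simp)
      (hsum.norm.mul_right (Real.exp (‖q * a / c‖ * (1 - ‖q‖)⁻¹) *
        Real.exp (‖q * a‖ * (1 - ‖q‖)⁻¹))) fun k w hw => ?_))
    · have h1 := (differentiable_qPochInf hq1).comp
        (by fun_prop : Differentiable ℂ fun x => q * a * x * q ^ k)
      have h2 : Differentiable ℂ fun x => qPoch (q * a * x / c) q k := by
        unfold qPoch; fun_prop
      exact (differentiable_const _).mul (h2.mul h1)
    · rw [norm_mul, norm_mul]
      gcongr
      · refine norm_qPoch_le hq1 ?_ k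
        rw [mul_div_right_comm, norm_mul]
        exact mul_le_of_le_one_right (norm_nonneg _) hw
      · refine norm_qPochInf_le hq1 ?_
        rw [norm_mul, norm_mul (q * a), norm_pow, mul_assoc]
        exact mul_le_of_le_one_right (norm_nonneg _)
          (mul_le_one₀ hw (by positivity) (pow_le_one₀ (norm_nonneg q) hq1.le))
  have hcont' : ContinuousAt (vwpEntire q a b c d) 0 :=
    (differentiable_vwpEntire hq0 hq1 hB hC hD).continuous.continuousAt
  have hsmall : ∀ᶠ x : ℂ in 𝓝[≠] 0, ‖q * a * x‖ < 1 := by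
    have : Tendsto (fun x : ℂ => ‖q * a * x‖) (𝓝 0) (𝓝 ‖q * a * 0‖) :=
      Continuous.tendsto (by fun_prop) 0
    rw [mul_zero, norm_zero] at this
    exact (this.mono_left nhdsWithin_le_nhds).eventually_lt_const zero_lt_one
  have heq : vwpEntire q a b c d =ᶠ[𝓝[≠] 0] (fun x => K * ∑' k, g k * (qPoch (q * a * x / c) q k *
      qPochInf (q * a * x * q ^ k) q)) := by
    filter_upwards [hsmall, self_mem_nhdsWithin] with x hx hx0
    have hx0 : x ≠ 0 := hx0
    have hX : q * a / x⁻¹ ∉ OmegaQ q := by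
      rw [div_inv_eq_mul]; exact notMem_OmegaQ_of_norm_lt hq0 hq1 hx
    have h1 := vwp_one_mul_qPochInf (b := b) (c := c) (d := d) hq0 hq1 hs hs' (inv_ne_zero hx0) hX
    -- The roles of `(b, c, d, e)` are played by `(c, x⁻¹, b, d)`; the convergence condition becomes
    -- one on `b` and `d` alone.
    have h2 := vwp_one_eq hq0 hq1 hC hX hB hc (inv_ne_zero hx0) hb hs hs' hd hD (by tauto)
    have hperm : vwp 1 a [c, x⁻¹, b, d] q (q ^ 2 * a ^ 2 / (c * x⁻¹ * b * d)) =
        vwp 1 a [b, c, d, x⁻¹] q (q ^ 2 * a ^ 2 / (b * c * d * x⁻¹)) := by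
      refine tsum_congr fun k => ?_
      rw [show c * x⁻¹ * b * d = b * c * d * x⁻¹ by ring]
      simp [vwpTerm, phiTerm, zeroNum, zeroDen, vwpNum, vwpDen, qPochList, -mul_eq_mul_right_iff]
      ring
    rw [inv_inv] at h1
    rw [← h1, ← hperm, h2, div_inv_eq_mul]
    rw [mul_left_comm, phi, ← tsum_mul_left]
    congr 1
    refine tsum_congr fun k => ?_
    have n1 : qPoch (q * a * x) q k ≠ 0 := by
      rw [div_inv_eq_mul] at hX
      exact qPoch_ne_zero _ fun j _ => (notMem_OmegaQ_iff hq0).1 hX j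
    rw [hg, qPochInf_eq_mul hq1 _ k, phiTerm, phiTerm,
      show q * a / (c * x⁻¹) = q * a * x / c by field_simp]
    simp [qPochList]
    generalize qPoch (q * a / c) q k = Y
    generalize qPoch (q * a * x / c) q k = Y'
    generalize q * a / (b * d) = w
    generalize qPoch (q * a * x) q k = Z at *
    have i1 : Z * Z⁻¹ = 1 := mul_inv_cancel₀ n1
    linear_combination (qPochInf (q * a * x * q ^ k) q * Y' * qPoch b q k * qPoch d q k *
      (qPoch q q k)⁻¹ * Y⁻¹ * w ^ k) * i1
  have := tendsto_nhds_unique_of_eventuallyEq (hcont'.tendsto.mono_left nhdsWithin_le_nhds)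
    (hcont.tendsto.mono_left nhdsWithin_le_nhds) heq
  rw [this, phi, ← hg]
  have e0 : qPochInf 0 q = 1 := by simp [qPochInf]
  have e1 (k) : qPoch 0 q k = 1 := by simp [qPoch]
  simp [e0, e1]

theorem vwpEntire_zero_eq_two_two {q a b c d : ℂ} (hq0 : q ≠ 0) (hq1 : ‖q‖ < 1)
    (hB : q * a / b ∉ OmegaQ q) (hC : q * a / c ∉ OmegaQ q) (hD : q * a / d ∉ OmegaQ q)
    (hb : b ≠ 0) (hc : c ≠ 0) (hd : d ≠ 0) (ha1 : a ≠ 1) :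
    vwpEntire q a b c d 0 = qPochInf (q * a) q / qPochInf (q * a / d) q *
          phi [q * a / (b * c), d] [q * a / b, q * a / c] q (q * a / d) := by
  rw [vwpEntire_eq_phiProd_of_norm_lt hq0 hq1 hB hC hD hb hc hd ha1 (by simp), phiProd, phi,
    funext phiTerm_two_two_eq]
  simp [qPochInf]

theorem theorem2p2 (q a b c d : ℂ) (hq0 : q ≠ 0) (hq1 : ‖q‖ < 1)
    (ha : a ≠ 0) (hb : b ≠ 0) (hc : c ≠ 0) (hd : d ≠ 0)
    (hsa : a.sqrt ∉ OmegaQ q) (hsa' : -a.sqrt ∉ OmegaQ q)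
    (hqb : q * a / b ∉ OmegaQ q) (hqc : q * a / c ∉ OmegaQ q) (hqd : q * a / d ∉ OmegaQ q) :
    (∀ e : ℂ, e ≠ 0 → q * a / e ∉ OmegaQ q →
      -- the `₃φ₂` converges: its argument is in the unit disc, or it terminates
      (‖q * a / (d * e)‖ < 1 ∨
        q * a / (b * c) ∈ OmegaQ q ∨ d ∈ OmegaQ q ∨ e ∈ OmegaQ q) →
      Summable (vwpTerm 1 a [b, c, d, e] q (q ^ 2 * a ^ 2 / (b * c * d * e))) ∧
      Summable (phiTerm [q * a / (b * c), d, e] [q * a / b, q * a / c] q (q * a / (d * e))) ∧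
      vwp 1 a [b, c, d, e] q (q ^ 2 * a ^ 2 / (b * c * d * e)) =
        qPochInfList [q * a, q * a / (d * e)] q / qPochInfList [q * a / d, q * a / e] q *
          phi [q * a / (b * c), d, e] [q * a / b, q * a / c] q (q * a / (d * e))) ∧
    (Summable (vwpTerm 2 a [b, c, d] q (q ^ 2 * a ^ 2 / (b * c * d))) ∧
      Summable (phiTerm [q * a / (b * c), d] [q * a / b, q * a / c] q (q * a / d)) ∧
      vwp 2 a [b, c, d] q (q ^ 2 * a ^ 2 / (b * c * d)) =
        qPochInf (q * a) q / qPochInf (q * a / d) q *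
          phi [q * a / (b * c), d] [q * a / b, q * a / c] q (q * a / d)) ∧
    -- the `₂φ₁` converges: its argument is in the unit disc, or it terminates
    ((‖q * a / (b * d)‖ < 1 ∨ b ∈ OmegaQ q ∨ d ∈ OmegaQ q) →
      Summable (phiTerm [b, d] [q * a / c] q (q * a / (b * d))) ∧
      qPochInf (q * a) q / qPochInf (q * a / d) q *
          phi [q * a / (b * c), d] [q * a / b, q * a / c] q (q * a / d) =
        qPochInfList [q * a, q * a / (b * d)] q / qPochInfList [q * a / b, q * a / d] q *
          phi [b, d] [q * a / c] q (q * a / (b * d))) := by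
  have ha1 := ne_one_of_sqrt_notMem hq0 hsa
  have h22 := vwpEntire_zero_eq_two_two hq0 hq1 hqb hqc hqd hb hc hd ha1
  refine ⟨fun e he hE h => ⟨?_, summable_phiTerm_three_two hq0 hq1 hqb hqc he h,
    vwp_one_eq hq0 hq1 hqb hqc hqd hb hc hd hsa hsa' he hE h⟩, ⟨?_, ?_, ?_⟩, fun h =>
    ⟨summable_phiTerm_two_one hq0 hq1 hqc h, ?_⟩⟩
  · rw [funext (vwpTerm_one_eq hq0 hsa hsa' he)]
    exact summable_vwpCoeff_mul hq0 hq1 hqb hqc hqd _ (exists_norm_inv_qPoch_le hq0 hq1 hE)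
  · rw [funext (vwpTerm_two_eq hq0 hsa hsa')]
    simpa using summable_vwpCoeff_mul hq0 hq1 hqb hqc hqd 0 (g := fun _ => 1) ⟨1, by simp⟩
  · rw [funext phiTerm_two_two_eq]
    exact summable_phiCoeff_mul hq0 hq1 hqb hqc (by simp)
  · rw [← h22, vwp, vwpEntire, funext (vwpTerm_two_eq hq0 hsa hsa')]
    simp [qPochInf]
  · rw [← h22, vwpEntire_zero_eq hq0 hq1 hqb hqc hqd hb hc hd hsa hsa' h]
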